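/- Let $n\ge 1$ and let $f\in\mathbb{C}\{x\}=\mathbb{C}\{x_1,\dots,x_n\}$ be a convergent power series with $f(0)=0$ and an isolated critical point at the origin, i.e. $\langle x\rangle^m\subseteq\langle\partial_1(f),\dots,\partial_n(f)\rangle\subseteq\langle x\rangle$ for some $m\ge1$, where $\partial_i=\partial/\partial x_i$. Let $\Omega^p$ and $\widehat\Omega^p$ be the modules of differential $p$-forms in $x_1,\dots,x_n$ with coefficients in $\mathbb{C}\{x\}$ and in $\mathbb{C}[\![x]\!]$, respectively. Let $H''=\Omega^n/\mathrm{d}f\wedge\mathrm{d}\Omega^{n-2}$ be the Brieskorn lattice (with $\Omega^{-1}=0$), and let the formal Brieskorn lattice $$\widehat H''=\varprojlim_k\ \Omega^n\big/\bigl(\langle x\rangle^k\Omega^n+\mathrm{d}f\wedge\mathrm{d}\Omega^{n-2}\bigr)$$ be its completion with respect to the $\langle x\rangle$-adic topology. Let $\langle\partial(f)-s\partial\rangle\mathbb{C}[\![s,x]\!]$ be the set of all $\sum_{i=1}^n\bigl(\partial_i(f)g_i-s\,\partial_i(g_i)\bigr)$ with $g_1,\dots,g_n\in\mathbb{C}[\![s,x]\!]$,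 and let $\mathrm{d}f-s\,\mathrm{d}$ denote the $\mathbb{C}[\![s]\!]$-linear operator $\omega\mapsto \mathrm{d}f\wedge\omega-s\,\mathrm{d}\omega$, where $\mathrm{d}$ acts coefficientwise in $s$. 1. The map $g\mapsto g\,\mathrm{d}x_1\wedge\cdots\wedge\mathrm{d}x_n$ induces an isomorphism of $\mathbb{C}[\![s]\!]$-modules $$\mathbb{C}[\![s,x]\!]\big/\langle\partial(f)-s\partial\rangle\mathbb{C}[\![s,x]\!]\ \xrightarrow{\ \sim\ }\ \widehat\Omega^n[\![s]\!]\big/(\mathrm{d}f-s\,\mathrm{d})\widehat\Omega^{n-1}[\![s]\!].$$ 2. Suppose $n\ge2$. There is exactly one $\mathbb{C}[\![s]\!]$-module structure on $\widehat H''$ that extends its complex vector space structure, for which multiplication by $s$ is continuous for the $\langle x\rangle$-adic topology and satisfies $s\cdot[\mathrm{d}\eta]=[\mathrm{d}f\wedge\eta]$ for all $\eta\in\Omega^{n-1}$, and for which every power series in $s$ acts as the $\langle x\rangle$-adic limit of its truncations. Every element of $\widehat H''$ is represented by a formal form $\omega\in\widehat\Omega^n$ (meaning that, for every $k$, its $k$-th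 component is the class of an element of $\Omega^n$ congruent to $\omega$ modulo $\langle x\rangle^k\widehat\Omega^n$), and the inclusion $\widehat\Omega^n\subset\widehat\Omega^n[\![s]\!]$ induces, via $[\omega]\mapsto[\omega]$ on representatives, an isomorphism of $\mathbb{C}[\![s]\!]$-modules $$\widehat H''\ \xrightarrow{\ \sim\ }\ \widehat\Omega^n[\![s]\!]\big/(\mathrm{d}f-s\,\mathrm{d})\widehat\Omega^{n-1}[\![s]\!].$$ -/

import Mathlib

noncomputable section

namespace Brieskorn

/-! ### Differential forms in the coordinates `x_1, …, x_n` -/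

/-- Differential forms of degree `p` in `n` variables with coefficients in `R`: the form
`∑_I ω_I dx_I`, where `I = {i_1 < ⋯ < i_p}` runs over the `p`-element subsets of the index set and
`dx_I = dx_{i_1} ∧ ⋯ ∧ dx_{i_p}`, is the family of its coefficients `ω_I`. The degree is an
integer, and the module of forms of negative degree is zero. -/
abbrev Form (R : Type*) (n : ℕ) (p : ℤ) : Type _ :=
  {I : Finset (Fin n) // (I.card : ℤ) = p} → R

/-- The index `I \ {j}` of degree `p` for `j ∈ I` and `I` of degree `q = p + 1`. -/
def eraseIdx {n : ℕ} {p q : ℤ} (h : p + 1 = q) (I : {I : Finset (Fin n) // (I.card : ℤ) = q})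
    (j : {j // j ∈ I.1}) : {I : Finset (Fin n) // (I.card : ℤ) = p} :=
  ⟨I.1.erase j.1, by
    have h1 := Finset.card_erase_add_one j.2
    have h2 := I.2
    omega⟩

/-- The sign in `dx_j ∧ dx_{I \ {j}} = ± dx_I`, which is `(-1)^#{i ∈ I | i < j}`. -/
def sgn {n : ℕ} (I : Finset (Fin n)) (j : Fin n) : ℤ :=
  (-1) ^ (I.filter (fun i => i < j)).card

/-- The operator `ω ↦ ∑_j dx_j ∧ T_j(ω)`, where the operators `T_j` act on the coefficients. -/
def wedgeOp {k R : Type*} [CommRing k] [CommRing R] [Algebra k R] {n : ℕ}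
    (T : Fin n → R →ₗ[k] R) {p q : ℤ} (h : p + 1 = q) : Form R n p →ₗ[k] Form R n q :=
  LinearMap.pi fun I => ∑ j : {j // j ∈ I.1},
    sgn I.1 j.1 • (T j.1 ∘ₗ LinearMap.proj (eraseIdx h I j))

/-- The operator `ω ↦ α ∧ ω` for the one-form `α = ∑_j a_j dx_j`. -/
def wedge (k : Type*) {R : Type*} [CommRing k] [CommRing R] [Algebra k R] {n : ℕ}
    (a : Fin n → R) {p q : ℤ} (h : p + 1 = q) : Form R n p →ₗ[k] Form R n q :=
  wedgeOp (fun j => LinearMap.mulLeft k (a j)) h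

/-- The form `g dx_1 ∧ ⋯ ∧ dx_n`. -/
def topForm {R : Type*} (n : ℕ) (g : R) : Form R n (n : ℤ) := fun _ => g

/-! ### Convergent power series -/

/-- A power series in `x_1, …, x_n` over `ℂ` is convergent if it converges absolutely at
`(r, …, r)` for some `r > 0`. -/
def IsConvergent {n : ℕ} (f : MvPowerSeries (Fin n) ℂ) : Prop :=
  ∃ r : ℝ, 0 < r ∧ Summable fun α : Fin n →₀ ℕ => ‖MvPowerSeries.coeff α f‖ * r ^ α.degree

theorem IsConvergent.exists_le {n : ℕ} {f g : MvPowerSeries (Fin n) ℂ}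
    (hf : IsConvergent f) (hg : IsConvergent g) : ∃ r : ℝ, 0 < r ∧
      (Summable fun α : Fin n →₀ ℕ => ‖MvPowerSeries.coeff α f‖ * r ^ α.degree) ∧
      Summable fun α : Fin n →₀ ℕ => ‖MvPowerSeries.coeff α g‖ * r ^ α.degree := by
  obtain ⟨r, hr, h⟩ := hf
  obtain ⟨t, ht, h'⟩ := hg
  refine ⟨min r t, lt_min hr ht, ?_, ?_⟩
  · refine Summable.of_nonneg_of_le (fun α => by positivity) (fun α => ?_) h
    gcongr
    exact min_le_left _ _
  · refine Summable.of_nonneg_of_le (fun α => by positivity) (fun α => ?_) h'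
    gcongr
    exact min_le_right _ _

theorem isConvergent_C {n : ℕ} (a : ℂ) :
    IsConvergent (MvPowerSeries.C a : MvPowerSeries (Fin n) ℂ) := by
  classical
  refine ⟨1, one_pos, summable_of_ne_finset_zero (s := {0}) fun α hα => ?_⟩
  have : α ≠ 0 := by simpa using hα
  simp [MvPowerSeries.coeff_C, this]

theorem IsConvergent.add {n : ℕ} {f g : MvPowerSeries (Fin n) ℂ}
    (hf : IsConvergent f) (hg : IsConvergent g) : IsConvergent (f + g) := by
  obtain ⟨r, hr, h, h'⟩ := hf.exists_le hg
  refine ⟨r, hr, Summable.of_nonneg_of_le (fun α => by positivity) (fun α => ?_) (h.add h')⟩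
  rw [map_add, ← add_mul]
  gcongr
  exact norm_add_le _ _

theorem IsConvergent.mul {n : ℕ} {f g : MvPowerSeries (Fin n) ℂ}
    (hf : IsConvergent f) (hg : IsConvergent g) : IsConvergent (f * g) := by
  classical
  obtain ⟨r, hr, h, h'⟩ := hf.exists_le hg
  have h0 : ∀ (u : MvPowerSeries (Fin n) ℂ) (α : Fin n →₀ ℕ),
      0 ≤ ‖MvPowerSeries.coeff α u‖ * r ^ α.degree := fun u α => by positivity
  have key := summable_sum_mul_antidiagonal_of_summable_mul
    (Summable.mul_of_nonneg h h' (Pi.le_def.2 (h0 f)) (Pi.le_def.2 (h0 g)))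
  refine ⟨r, hr, Summable.of_nonneg_of_le (fun α => by positivity) (fun α => ?_) key⟩
  rw [MvPowerSeries.coeff_mul]
  calc _ ≤ (∑ p ∈ Finset.HasAntidiagonal.antidiagonal α,
            ‖MvPowerSeries.coeff p.1 f * MvPowerSeries.coeff p.2 g‖) * r ^ α.degree := by
        gcongr
        exact norm_sum_le _ _
    _ = _ := by
        rw [Finset.sum_mul]
        refine Finset.sum_congr rfl fun p hp => ?_
        rw [← Finset.HasAntidiagonal.mem_antidiagonal.1 hp, map_add, pow_add, norm_mul]
        ring

theorem IsConvergent.pderiv {n : ℕ} {f : MvPowerSeries (Fin n) ℂ} (hf : IsConvergent f)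
    (i : Fin n) : IsConvergent (MvPowerSeries.pderiv ℂ i f) := by
  obtain ⟨r, hr, h⟩ := hf
  have hinj : Function.Injective fun α : Fin n →₀ ℕ => α + Finsupp.single i 1 :=
    fun a b hab => by simpa using hab
  refine ⟨r / 2, by positivity, Summable.of_nonneg_of_le (fun α => by positivity) (fun α => ?_)
    ((h.comp_injective hinj).mul_left r⁻¹)⟩
  have h1 : α i ≤ α.degree := Finsupp.le_degree i α
  have h2 : ((α i : ℝ) + 1) ≤ 2 ^ α.degree := by
    have h3 : α i + 1 ≤ 2 ^ α.degree := (Nat.succ_le_succ h1).trans Nat.lt_two_pow_self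
    exact_mod_cast h3
  have h4 : ‖((α i : ℂ) + 1)‖ = (α i : ℝ) + 1 := by
    have : ((α i : ℂ) + 1) = ((α i + 1 : ℕ) : ℂ) := by push_cast; ring
    rw [this, Complex.norm_natCast]
    push_cast
    ring
  simp only [Function.comp, MvPowerSeries.coeff_pderiv, norm_mul, h4, map_add,
    Finsupp.degree_single, pow_add, pow_one]
  have h5 : ((α i : ℝ) + 1) * (r / 2) ^ α.degree ≤ r ^ α.degree := by
    calc _ ≤ 2 ^ α.degree * (r / 2) ^ α.degree := by gcongr
      _ = _ := by rw [← mul_pow]; congr 1; ring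
  calc _ = ‖MvPowerSeries.coeff (α + Finsupp.single i 1) f‖ *
            (((α i : ℝ) + 1) * (r / 2) ^ α.degree) := by ring
    _ ≤ ‖MvPowerSeries.coeff (α + Finsupp.single i 1) f‖ * r ^ α.degree := by gcongr
    _ = _ := by field_simp

/-- The ring `ℂ{x}` of convergent power series, as a subalgebra of `ℂ⟦x⟧`. -/
def Conv (n : ℕ) : Subalgebra ℂ (MvPowerSeries (Fin n) ℂ) where
  carrier := {f | IsConvergent f}
  mul_mem' := IsConvergent.mul
  add_mem' := IsConvergent.add
  algebraMap_mem' := isConvergent_C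

theorem isConvergent_X {n : ℕ} (i : Fin n) :
    IsConvergent (MvPowerSeries.X i : MvPowerSeries (Fin n) ℂ) := by
  classical
  refine ⟨1, one_pos, summable_of_ne_finset_zero (s := {Finsupp.single i 1}) fun α hα => ?_⟩
  have : α ≠ Finsupp.single i 1 := by simpa using hα
  simp [MvPowerSeries.coeff_X, this]

/-- The coordinate `x_i`, as an element of `ℂ{x}`. -/
def convX {n : ℕ} (i : Fin n) : Conv n := ⟨MvPowerSeries.X i, isConvergent_X i⟩

/-- The partial derivative `∂_i` on `ℂ{x}`. -/
def convD {n : ℕ} (i : Fin n) : Conv n →ₗ[ℂ] Conv n :=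
  (MvPowerSeries.pderiv ℂ i).toLinearMap.restrict
    (p := Subalgebra.toSubmodule (Conv n)) (q := Subalgebra.toSubmodule (Conv n))
    fun _ hf => IsConvergent.pderiv hf i

/-- The ideal `⟨x⟩` of `ℂ{x}`. -/
def convIdeal (n : ℕ) : Ideal (Conv n) := Ideal.span (Set.range convX)

/-- The ideal `⟨∂(f)⟩` of `ℂ{x}` generated by the partial derivatives of `f`. -/
def jacobianIdeal {n : ℕ} (f : Conv n) : Ideal (Conv n) :=
  Ideal.span (Set.range fun i => convD i f)

/-- The origin is an isolated critical point of `f`: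
`⟨x⟩^m ⊆ ⟨∂(f)⟩ ⊆ ⟨x⟩` for some `m ≥ 1`. -/
def HasIsolatedCriticalPoint {n : ℕ} (f : Conv n) : Prop :=
  (∃ m : ℕ, 1 ≤ m ∧ convIdeal n ^ m ≤ jacobianIdeal f) ∧ jacobianIdeal f ≤ convIdeal n

/-! ### The Brieskorn lattice and its completion -/

/-- The exterior derivative on germs of holomorphic forms. -/
def convExt {n : ℕ} {p q : ℤ} (h : p + 1 = q) : Form (Conv n) n p →ₗ[ℂ] Form (Conv n) n q :=
  wedgeOp convD h

/-- The operator `ω ↦ df ∧ ω` on germs of holomorphic forms. -/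
def convDf {n : ℕ} (f : Conv n) {p q : ℤ} (h : p + 1 = q) :
    Form (Conv n) n p →ₗ[ℂ] Form (Conv n) n q :=
  wedge ℂ (fun j => convD j f) h

/-- The subspace `df ∧ dΩ^{n-2}` of `Ω^n`. -/
def exactPart {n : ℕ} (f : Conv n) : Submodule ℂ (Form (Conv n) n (n : ℤ)) :=
  LinearMap.range (convDf f (sub_add_cancel (n : ℤ) 1) ∘ₗ
    convExt (show (n : ℤ) - 2 + 1 = n - 1 by ring))

/-- The Brieskorn lattice `H'' = Ω^n / df ∧ dΩ^{n-2}`. -/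
abbrev Lattice {n : ℕ} (f : Conv n) : Type := Form (Conv n) n (n : ℤ) ⧸ exactPart f

/-- The image of `⟨x⟩^k Ω^n` in `H''`; these subspaces define the `⟨x⟩`-adic topology. -/
def filt {n : ℕ} (f : Conv n) (k : ℕ) : Submodule ℂ (Lattice f) :=
  (((convIdeal n ^ k) • (⊤ : Submodule (Conv n) (Form (Conv n) n (n : ℤ)))).restrictScalars ℂ).map
    (exactPart f).mkQ

theorem filt_succ_le {n : ℕ} (f : Conv n) (k : ℕ) : filt f (k + 1) ≤ filt f k := by
  refine Submodule.map_mono fun x hx => ?_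
  exact Submodule.smul_mono_left (Ideal.pow_le_pow_right (Nat.le_succ k)) hx

/-- The quotient of `H''` by the image of `⟨x⟩^k Ω^n`. -/
abbrev LatticeMod {n : ℕ} (f : Conv n) (k : ℕ) : Type := Lattice f ⧸ filt f k

instance instAddCommGroupLatticeMod {n : ℕ} (f : Conv n) (k : ℕ) : AddCommGroup (LatticeMod f k) :=
  Submodule.Quotient.addCommGroup _

instance instModuleLatticeMod {n : ℕ} (f : Conv n) (k : ℕ) : Module ℂ (LatticeMod f k) :=
  Submodule.Quotient.module _

/-- The transition map of the inverse system of these quotients. -/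
def transition {n : ℕ} (f : Conv n) (k : ℕ) : LatticeMod f (k + 1) →ₗ[ℂ] LatticeMod f k :=
  Submodule.factor (filt_succ_le f k)

/-- The formal Brieskorn lattice `Ĥ''`: the completion of `H''` with respect to the `⟨x⟩`-adic
topology, that is, the inverse limit of the quotients of `H''` by the images of `⟨x⟩^k Ω^n`. -/
def completion {n : ℕ} (f : Conv n) : Submodule ℂ (∀ k : ℕ, LatticeMod f k) where
  carrier := {h | ∀ k, transition f k (h (k + 1)) = h k}
  add_mem' := fun ha hb k => by simp [ha k, hb k]
  zero_mem' := fun k => by simp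
  smul_mem' := fun c a ha k => by simp [ha k]

/-- The type of elements of the formal Brieskorn lattice `Ĥ''`. -/
abbrev FormalLattice {n : ℕ} (f : Conv n) : Type := completion f

/-- The natural map `Ω^n → H'' → Ĥ''`. -/
def toFormal {n : ℕ} (f : Conv n) (ω : Form (Conv n) n (n : ℤ)) : FormalLattice f :=
  ⟨fun k => (filt f k).mkQ ((exactPart f).mkQ ω), fun _ => rfl⟩

/-- The `ℂ⟦s⟧`-module structure of the formal Brieskorn lattice: it extends the structure of a
complex vector space, `s` is the operator with `s · [dη] = [df ∧ η]` on classes of holomorphic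
forms, extended continuously for the `⟨x⟩`-adic topology, and a power series in `s` acts as the
`⟨x⟩`-adic limit of its truncations. -/
structure IsFormalLatticeModule {n : ℕ} (f : Conv n)
    [Module (PowerSeries ℂ) (FormalLattice f)] : Prop where
  C_smul : ∀ (a : ℂ) (h : FormalLattice f), (PowerSeries.C a : PowerSeries ℂ) • h = a • h
  X_smul : ∀ η : Form (Conv n) n ((n : ℤ) - 1),
    (PowerSeries.X : PowerSeries ℂ) • toFormal f (convExt (sub_add_cancel (n : ℤ) 1) η) =
      toFormal f (convDf f (sub_add_cancel (n : ℤ) 1) η)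
  X_continuous : ∀ k : ℕ, ∃ m : ℕ, ∀ h : FormalLattice f, h.1 m = 0 →
    ((PowerSeries.X : PowerSeries ℂ) • h).1 k = 0
  smul_limit : ∀ (u : PowerSeries ℂ) (h : FormalLattice f) (k : ℕ), ∃ N : ℕ, ∀ M ≥ N,
    (u • h).1 k = (((PowerSeries.trunc M u : Polynomial ℂ) : PowerSeries ℂ) • h).1 k

/-! ### Formal forms -/

/-- The ideal `⟨x⟩` of `ℂ⟦x⟧`. -/
def formalIdeal (n : ℕ) : Ideal (MvPowerSeries (Fin n) ℂ) :=
  Ideal.span (Set.range MvPowerSeries.X)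

/-- The formal form `ω` in `Ω̂^n` represents the element `h` of `Ĥ''`: for every `k`, the `k`-th
component of `h` is the class of a holomorphic form congruent to `ω` modulo `⟨x⟩^k Ω̂^n`. -/
def Represents {n : ℕ} (f : Conv n) (ω : Form (MvPowerSeries (Fin n) ℂ) n (n : ℤ))
    (h : FormalLattice f) : Prop :=
  ∀ k : ℕ, ∃ ω' : Form (Conv n) n (n : ℤ), h.1 k = (toFormal f ω').1 k ∧
    ω - (fun I => (ω' I : MvPowerSeries (Fin n) ℂ)) ∈
      (formalIdeal n ^ k) •
        (⊤ : Submodule (MvPowerSeries (Fin n) ℂ) (Form (MvPowerSeries (Fin n) ℂ) n (n : ℤ)))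

/-- Forms with coefficients in `ℂ⟦x⟧⟦s⟧`: this is `Ω̂^p⟦s⟧`. -/
abbrev FormS (n : ℕ) (p : ℤ) : Type := Form (PowerSeries (MvPowerSeries (Fin n) ℂ)) n p

/-- The partial derivative `∂_i` on `ℂ⟦x⟧⟦s⟧`, acting on the coefficients of the powers of `s`;
it is `ℂ⟦s⟧`-linear. -/
def seriesD {n : ℕ} (i : Fin n) : PowerSeries (MvPowerSeries (Fin n) ℂ) →ₗ[PowerSeries ℂ]
    PowerSeries (MvPowerSeries (Fin n) ℂ) where
  toFun g := PowerSeries.mk fun k => MvPowerSeries.pderiv ℂ i (PowerSeries.coeff k g)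
  map_add' g g' := by ext1; simp
  map_smul' u g := by
    ext1 k
    have hc : ∀ m, MvPowerSeries.pderiv ℂ i (PowerSeries.coeff m (algebraMap (PowerSeries ℂ)
        (PowerSeries (MvPowerSeries (Fin n) ℂ)) u)) = 0 := fun m => by
      have : PowerSeries.coeff m (algebraMap (PowerSeries ℂ)
          (PowerSeries (MvPowerSeries (Fin n) ℂ)) u) =
          algebraMap ℂ (MvPowerSeries (Fin n) ℂ) (PowerSeries.coeff m u) := rfl
      rw [this, Derivation.map_algebraMap]
    simp [Algebra.smul_def, PowerSeries.coeff_mul, hc]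

/-- The operator `df - s d`, `ω ↦ df ∧ ω - s dω`, from `Ω̂^{n-1}⟦s⟧` to `Ω̂^n⟦s⟧`. -/
def twistedD {n : ℕ} (f : Conv n) : FormS n ((n : ℤ) - 1) →ₗ[PowerSeries ℂ] FormS n (n : ℤ) :=
  wedge (PowerSeries ℂ)
      (fun j => PowerSeries.C (MvPowerSeries.pderiv ℂ j (f : MvPowerSeries (Fin n) ℂ)))
      (sub_add_cancel (n : ℤ) 1) -
    (PowerSeries.X : PowerSeries ℂ) • wedgeOp seriesD (sub_add_cancel (n : ℤ) 1)

/-- The `ℂ⟦s⟧`-module `Ω̂^n⟦s⟧ / (df - s d)Ω̂^{n-1}⟦s⟧`. -/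
abbrev TwistedQuotient {n : ℕ} (f : Conv n) : Type :=
  FormS n (n : ℤ) ⧸ LinearMap.range (twistedD f)

/-- The inclusion `Ω̂^n ⊆ Ω̂^n⟦s⟧` as the forms which do not depend on `s`. -/
def constForm {n : ℕ} (ω : Form (MvPowerSeries (Fin n) ℂ) n (n : ℤ)) : FormS n (n : ℤ) :=
  fun I => PowerSeries.C (ω I)

/-! ### The ring `ℂ⟦s, x⟧` -/

/-- The ring `ℂ⟦s, x_1, …, x_n⟧`; the variable `s` has the index `none`, and the variable `x_i`
has the index `some i`. -/
abbrev SX (n : ℕ) : Type := MvPowerSeries (Option (Fin n)) ℂ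

/-- `ℂ⟦s, x⟧` is an algebra over its subring `ℂ⟦s⟧`. -/
instance instAlgebraSX (n : ℕ) : Algebra (PowerSeries ℂ) (SX n) :=
  (MvPowerSeries.rename (R := ℂ) (fun _ : Unit => (none : Option (Fin n)))).toRingHom.toAlgebra

/-- The inclusion `ℂ⟦x⟧ ⊆ ℂ⟦s, x⟧`. -/
def inclX (n : ℕ) : MvPowerSeries (Fin n) ℂ →ₐ[ℂ] SX n :=
  MvPowerSeries.rename (R := ℂ) (some : Fin n → Option (Fin n))

theorem pderiv_some_algebraMap {n : ℕ} (i : Fin n) (u : PowerSeries ℂ) :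
    MvPowerSeries.pderiv ℂ (some i) (algebraMap (PowerSeries ℂ) (SX n) u) = 0 := by
  classical
  ext α
  rw [MvPowerSeries.coeff_pderiv]
  have : MvPowerSeries.coeff (α + Finsupp.single (some i) 1)
      (algebraMap (PowerSeries ℂ) (SX n) u) = 0 := by
    refine MvPowerSeries.coeff_rename_eq_zero (f := fun _ : Unit => (none : Option (Fin n))) u ?_
    rintro ⟨y, hy⟩
    have h := congrArg (fun β : Option (Fin n) →₀ ℕ => β (some i)) hy
    simp only [Finsupp.add_apply, Finsupp.single_eq_same] at h
    rw [Finsupp.mapDomain_of_notMem_range _ _ (by simp)] at h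
    omega
  simp [this]

/-- The partial derivative `∂_i = ∂/∂x_i` on `ℂ⟦s, x⟧`, which is `ℂ⟦s⟧`-linear. -/
def sxD {n : ℕ} (i : Fin n) : SX n →ₗ[PowerSeries ℂ] SX n where
  toFun := MvPowerSeries.pderiv ℂ (some i)
  map_add' := map_add _
  map_smul' u g := by
    simp [Algebra.smul_def, Derivation.leibniz, pderiv_some_algebraMap]

/-- The operator `∂(f) - s∂`, which maps the column `(g_1, …, g_n)` of elements of `ℂ⟦s, x⟧` to
`∑_i (∂_i(f) g_i - s ∂_i(g_i))`. -/
def familyOp {n : ℕ} (f : Conv n) : (Fin n → SX n) →ₗ[PowerSeries ℂ] SX n :=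
  ∑ i, (LinearMap.mulLeft (PowerSeries ℂ)
        (inclX n (MvPowerSeries.pderiv ℂ i (f : MvPowerSeries (Fin n) ℂ))) -
      (PowerSeries.X : PowerSeries ℂ) • sxD i) ∘ₗ LinearMap.proj i

/-- The `ℂ⟦s⟧`-module `ℂ⟦s, x⟧ / ⟨∂(f) - s∂⟩ℂ⟦s, x⟧`. -/
abbrev FamilyQuotient {n : ℕ} (f : Conv n) : Type := SX n ⧸ LinearMap.range (familyOp f)

end Brieskorn

end

noncomputable section

namespace Brieskorn

open MvPowerSeries (coeff)

/-! ### Coefficients of forms at arbitrary index sets -/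

/-! The first isomorphism is bookkeeping: a top form has one coefficient, an (n-1)-form is a column
of n coefficients up to signs, and under ℂ⟦s,x⟧ = ℂ⟦x⟧⟦s⟧ the operator ∂(f) - s∂ on columns becomes
df - s d (`map_range_familyOp`).

The second rests on an explicit Poincaré lemma. Contraction with the Euler field, divided by total
weight, gives a homotopy h with dh + hd = id in degrees ≥ 1 (`formalExt_homotopy`), which preserves
convergence and never lowers the order. On top forms dh = id, so S = df ∧ h realises dη ↦ df ∧ η.
Two facts drive everything: S raises the order by one, because the ∂_i(f) vanish at 0, and for n ≥ 2
it is compatible with E = df ∧ dΩ̂^{n-2}, since a primitive is then unique up to dΩ̂^{n-2}.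

Both Ĥ'' and the twisted quotient are quotients of Ω̂^n by E. Surjectivity onto the twisted
quotient: s acts on [ω] by S, so ∑ s^m v_m has the class of the convergent sum ∑ S^m v_m. Its
kernel: if ω = (df - s d)∑ s^m η_m, then ω = df ∧ η_0 and df ∧ η_{m+1} = dη_m, so df ∧ η_m ≡ S(df ∧
η_{m+1}) modulo E; iterating, ω lies in E up to arbitrarily high order. A form also maps to 0 in Ĥ''
exactly when it lies in E up to every order. In both cases one concludes because E is closed
(`mem_range_of_forall_ordForm`), which is linear compactness of spaces of power series. Surjectivity
onto Ĥ'' is completeness of Ω̂^n.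

The module structure on Ĥ'' is transported from the twisted quotient. It is unique because classes
of exact holomorphic forms are dense, so continuity determines s, hence polynomials in s, hence by
limits all power series. -/

/-- The coefficient of a form at an arbitrary index set, zero if the degree does not match. -/
def Form.coef {R : Type*} [Zero R] {n : ℕ} {p : ℤ} (ω : Form R n p) (J : Finset (Fin n)) : R :=
  if h : (J.card : ℤ) = p then ω ⟨J, h⟩ else 0

theorem Form.coef_coe {R : Type*} [Zero R] {n : ℕ} {p : ℤ} (ω : Form R n p)
    (I : {I : Finset (Fin n) // (I.card : ℤ) = p}) : Form.coef ω I.1 = ω I := by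
  simp [Form.coef, I.2]

theorem Form.coef_map {R S : Type*} [Zero R] [Zero S] {n : ℕ} {p : ℤ} (ω : Form R n p)
    (φ : R → S) (hφ : φ 0 = 0) (J : Finset (Fin n)) :
    Form.coef (fun I => φ (ω I)) J = φ (Form.coef ω J) := by
  unfold Form.coef
  split_ifs <;> simp [hφ]

/-- Trades the sum over a subtype with dependent indices for a sum over a plain `Finset`, so that
double sums can be rearranged. -/
theorem wedgeOp_apply {k R : Type*} [CommRing k] [CommRing R] [Algebra k R] {n : ℕ}
    (T : Fin n → R →ₗ[k] R) {p q : ℤ} (h : p + 1 = q) (ω : Form R n p)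
    (I : {I : Finset (Fin n) // (I.card : ℤ) = q}) :
    wedgeOp T h ω I = ∑ j ∈ I.1, sgn I.1 j • T j (Form.coef ω (I.1.erase j)) := by
  rw [← Finset.sum_coe_sort]
  simp only [wedgeOp, LinearMap.pi_apply, LinearMap.sum_apply, LinearMap.smul_apply,
    LinearMap.comp_apply, LinearMap.proj_apply]
  refine Finset.sum_congr rfl fun j _ => ?_
  exact congrArg _ (congrArg _ (Form.coef_coe ω (eraseIdx h I j)).symm)

theorem Form.coef_wedgeOp {k R : Type*} [CommRing k] [CommRing R] [Algebra k R] {n : ℕ}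
    (T : Fin n → R →ₗ[k] R) {p q : ℤ} (h : p + 1 = q) (ω : Form R n p)
    {J : Finset (Fin n)} (hJ : (J.card : ℤ) = q) :
    Form.coef (wedgeOp T h ω) J = ∑ j ∈ J, sgn J j • T j (Form.coef ω (J.erase j)) := by
  rw [← wedgeOp_apply T h ω ⟨J, hJ⟩]
  exact Form.coef_coe _ ⟨J, hJ⟩

/-- `wedgeOp` is natural in the coefficients. -/
theorem map_wedgeOp {k R k' S : Type*} [CommRing k] [CommRing R] [Algebra k R] [CommRing k']
    [CommRing S] [Algebra k' S] {n : ℕ} (T : Fin n → R →ₗ[k] R) (T' : Fin n → S →ₗ[k'] S)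
    (φ : R →+ S) (hφ : ∀ j x, φ (T j x) = T' j (φ x)) {p q : ℤ} (h : p + 1 = q) (ω : Form R n p) :
    (fun I => φ (wedgeOp T h ω I)) = wedgeOp T' h fun I => φ (ω I) := by
  funext I
  simp only [wedgeOp_apply, map_sum, map_zsmul, hφ]
  refine Finset.sum_congr rfl fun j _ => ?_
  rw [Form.coef_map ω φ (map_zero φ)]

/-! ### Signs -/

theorem sgn_mul_self {n : ℕ} (I : Finset (Fin n)) (j : Fin n) : sgn I j * sgn I j = 1 := by
  rw [sgn, ← mul_pow]
  simp

theorem sgn_erase_of_lt {n : ℕ} {I : Finset (Fin n)} {j k : Fin n} (h : j < k) :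
    sgn (I.erase k) j = sgn I j := by
  unfold sgn
  congr 2
  ext i
  simp only [Finset.mem_filter, Finset.mem_erase]
  constructor
  · tauto
  · rintro ⟨h1, h2⟩
    exact ⟨⟨(h2.trans h).ne, h1⟩, h2⟩

theorem sgn_erase_of_gt {n : ℕ} {I : Finset (Fin n)} {j k : Fin n} (hj : j ∈ I) (h : j < k) :
    sgn (I.erase j) k = -sgn I k := by
  unfold sgn
  have h1 : (I.erase j).filter (· < k) = (I.filter (· < k)).erase j := Finset.filter_erase _ _ _
  have h2 := Finset.card_erase_add_one (Finset.mem_filter.2 ⟨hj, h⟩ : j ∈ I.filter (· < k))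
  rw [h1, ← h2, pow_succ]
  ring

/-- The sign rule dx_j ∧ dx_k = -dx_k ∧ dx_j: deleting the smaller index shifts the position of the
larger one by one, and deleting the larger one leaves the smaller in place. -/
theorem sgn_mul_sgn_erase {n : ℕ} {I : Finset (Fin n)} {j k : Fin n} (hj : j ∈ I) (hk : k ∈ I)
    (h : j ≠ k) : sgn I j * sgn (I.erase j) k = -(sgn I k * sgn (I.erase k) j) := by
  rcases lt_or_gt_of_ne h with h | h
  · rw [sgn_erase_of_gt hj h, sgn_erase_of_lt h]; ring
  · rw [sgn_erase_of_gt hk h, sgn_erase_of_lt h]; ring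

/-! ### Composition of two operators -/

theorem wedgeOp_wedgeOp_apply {k R : Type*} [CommRing k] [CommRing R] [Algebra k R] {n : ℕ}
    (S T : Fin n → R →ₗ[k] R) {p q r : ℤ} (h : p + 1 = q) (h' : q + 1 = r) (ω : Form R n p)
    (I : {I : Finset (Fin n) // (I.card : ℤ) = r}) :
    wedgeOp S h' (wedgeOp T h ω) I = ∑ x ∈ I.1.offDiag,
      (sgn I.1 x.1 * sgn (I.1.erase x.1) x.2) •
        S x.1 (T x.2 (Form.coef ω ((I.1.erase x.1).erase x.2))) := by
  have h1 : I.1.offDiag = (I.1.sigma fun j => I.1.erase j).map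
      (Equiv.sigmaEquivProd (Fin n) (Fin n)).toEmbedding := by
    ext ⟨a, b⟩
    simp only [Finset.mem_offDiag, Finset.mem_map_equiv, Finset.mem_sigma, Finset.mem_erase]
    simp [Equiv.sigmaEquivProd]
    tauto
  rw [h1, Finset.sum_map, Finset.sum_sigma, wedgeOp_apply]
  refine Finset.sum_congr rfl fun j hj => ?_
  have hc : ((I.1.erase j).card : ℤ) = q := by
    have := Finset.card_erase_add_one hj
    have := I.2
    omega
  rw [Form.coef_wedgeOp T h ω hc, map_sum, Finset.smul_sum]
  refine Finset.sum_congr rfl fun l _ => ?_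
  rw [map_zsmul, smul_smul]
  rfl

/-- Swapping the two indices pairs off the terms: the signs are antisymmetric and `F` is symmetric.
-/
theorem sum_offDiag_eq_zero {R : Type*} [AddCommGroup R] {n : ℕ} (I : Finset (Fin n))
    (F : Fin n → Fin n → R) (hF : ∀ j k, F j k = F k j) :
    ∑ x ∈ I.offDiag, (sgn I x.1 * sgn (I.erase x.1) x.2) • F x.1 x.2 = 0 := by
  refine Finset.sum_involution (fun x _ => (x.2, x.1)) ?_ ?_ ?_ ?_
  · rintro ⟨a, b⟩ hx
    obtain ⟨ha, hb, hab⟩ := Finset.mem_offDiag.1 hx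
    simp only
    rw [sgn_mul_sgn_erase ha hb hab, hF a b, neg_smul, neg_add_cancel]
  · rintro ⟨a, b⟩ hx _ h
    obtain ⟨ha, hb, hab⟩ := Finset.mem_offDiag.1 hx
    simp only [Prod.mk.injEq] at h
    exact hab h.2
  · rintro ⟨a, b⟩ hx
    obtain ⟨ha, hb, hab⟩ := Finset.mem_offDiag.1 hx
    exact Finset.mem_offDiag.2 ⟨hb, ha, hab.symm⟩
  · rintro ⟨a, b⟩ hx
    rfl

/-- The hypothesis asks only for symmetry of the summed expression, not that `S` and `T` commute:
∂_j does not commute with multiplication by ∂_l(f), but the defect ∂_j∂_l(f) is symmetric. -/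
theorem wedgeOp_wedgeOp_add {k R : Type*} [CommRing k] [CommRing R] [Algebra k R] {n : ℕ}
    (S T : Fin n → R →ₗ[k] R) (hST : ∀ j l x, S j (T l x) + T j (S l x) = S l (T j x) + T l (S j x))
    {p q r : ℤ} (h : p + 1 = q) (h' : q + 1 = r) (ω : Form R n p) :
    wedgeOp S h' (wedgeOp T h ω) + wedgeOp T h' (wedgeOp S h ω) = 0 := by
  funext I
  simp only [Pi.add_apply, wedgeOp_wedgeOp_apply, ← Finset.sum_add_distrib, ← smul_add]
  refine sum_offDiag_eq_zero I.1 (fun j l => S j (T l (Form.coef ω ((I.1.erase j).erase l))) +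
    T j (S l (Form.coef ω ((I.1.erase j).erase l)))) fun j l => ?_
  rw [hST, Finset.erase_right_comm]

theorem wedgeOp_wedgeOp_self {k R : Type*} [CommRing k] [CommRing R] [Algebra k R] {n : ℕ}
    (T : Fin n → R →ₗ[k] R) (hT : ∀ j l x, T j (T l x) = T l (T j x))
    {p q r : ℤ} (h : p + 1 = q) (h' : q + 1 = r) (ω : Form R n p) :
    wedgeOp T h' (wedgeOp T h ω) = 0 := by
  funext I
  rw [wedgeOp_wedgeOp_apply]
  refine sum_offDiag_eq_zero I.1 (fun j l => T j (T l (Form.coef ω ((I.1.erase j).erase l))))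
    fun j l => ?_
  rw [hT, Finset.erase_right_comm]

/-! ### Euler operators on formal power series -/

/-- Division of the coefficient of `x^α` by `c + |α|`. -/
def eulerInv (n c : ℕ) : MvPowerSeries (Fin n) ℂ →ₗ[ℂ] MvPowerSeries (Fin n) ℂ where
  toFun g := fun α => coeff α g / ((c + α.degree : ℕ) : ℂ)
  map_add' g g' := by
    ext α
    exact (by rw [map_add, add_div] : coeff α (g + g') / ((c + α.degree : ℕ) : ℂ) =
      coeff α g / ((c + α.degree : ℕ) : ℂ) + coeff α g' / ((c + α.degree : ℕ) : ℂ))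
  map_smul' a g := by
    ext α
    exact (by rw [map_smul, smul_eq_mul, mul_div_assoc] :
      coeff α (a • g) / ((c + α.degree : ℕ) : ℂ) = a * (coeff α g / ((c + α.degree : ℕ) : ℂ)))

theorem coeff_eulerInv {n : ℕ} (c : ℕ) (g : MvPowerSeries (Fin n) ℂ) (α : Fin n →₀ ℕ) :
    coeff α (eulerInv n c g) = coeff α g / ((c + α.degree : ℕ) : ℂ) := rfl

/-- ∂_i lowers the degree in x by one, and the shift of `c` compensates. As d raises the form degree
by one, division by the total weight thus commutes with d. -/
theorem pderiv_eulerInv {n : ℕ} (c : ℕ) (i : Fin n) (g : MvPowerSeries (Fin n) ℂ) :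
    MvPowerSeries.pderiv ℂ i (eulerInv n c g) =
      eulerInv n (c + 1) (MvPowerSeries.pderiv ℂ i g) := by
  ext α
  rw [MvPowerSeries.coeff_pderiv, coeff_eulerInv, coeff_eulerInv, MvPowerSeries.coeff_pderiv,
    map_add, Finsupp.degree_single]
  have : c + (α.degree + 1) = c + 1 + α.degree := by ring
  rw [this]
  ring

theorem coeff_X_mul_pderiv {n : ℕ} (i : Fin n) (g : MvPowerSeries (Fin n) ℂ) (α : Fin n →₀ ℕ) :
    coeff α (MvPowerSeries.X i * MvPowerSeries.pderiv ℂ i g) = (α i : ℂ) * coeff α g := by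
  classical
  rw [MvPowerSeries.X, MvPowerSeries.coeff_monomial_mul, one_mul]
  split_ifs with h
  · have h1 : α - Finsupp.single i 1 + Finsupp.single i 1 = α := tsub_add_cancel_of_le h
    have h2 := DFunLike.congr_fun h1 i
    simp only [Finsupp.add_apply, Finsupp.single_eq_same] at h2
    rw [MvPowerSeries.coeff_pderiv, h1, ← h2]
    push_cast
    ring
  · have h1 : α i = 0 := by simpa using h
    simp [h1]

theorem coeff_sum_X_mul_pderiv {n : ℕ} (g : MvPowerSeries (Fin n) ℂ) (α : Fin n →₀ ℕ) :
    coeff α (∑ i, MvPowerSeries.X i * MvPowerSeries.pderiv ℂ i g) =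
      (α.degree : ℂ) * coeff α g := by
  rw [map_sum, Finset.sum_congr rfl fun i _ => coeff_X_mul_pderiv i g α, ← Finset.sum_mul,
    Finsupp.degree_eq_sum]
  push_cast
  rfl

/-- The Euler operator c + ∑ x_i ∂_i multiplies x^α by c + |α|. The hypothesis excludes the single
bad case c = |α| = 0, where the division by zero returns 0. -/
theorem euler_eulerInv {n : ℕ} (c : ℕ) (g : MvPowerSeries (Fin n) ℂ)
    (h : c ≠ 0 ∨ coeff 0 g = 0) :
    (c : ℂ) • eulerInv n c g +
      ∑ i, MvPowerSeries.X i * MvPowerSeries.pderiv ℂ i (eulerInv n c g) = g := by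
  ext α
  rw [map_add, coeff_sum_X_mul_pderiv, map_smul, coeff_eulerInv, smul_eq_mul, ← add_mul]
  by_cases h0 : c + α.degree = 0
  · obtain ⟨rfl, h1⟩ : c = 0 ∧ α.degree = 0 := by omega
    obtain rfl : α = 0 := (Finsupp.degree_eq_zero_iff α).1 h1
    simp at h
    simp [h]
  · have : ((c + α.degree : ℕ) : ℂ) ≠ 0 := by exact_mod_cast h0
    rw [← Nat.cast_add, mul_div_cancel₀ _ this]

theorem IsConvergent.eulerInv {n : ℕ} (c : ℕ) {g : MvPowerSeries (Fin n) ℂ}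
    (hg : IsConvergent g) : IsConvergent (eulerInv n c g) := by
  obtain ⟨r, hr, h⟩ := hg
  refine ⟨r, hr, Summable.of_nonneg_of_le (fun α => by positivity) (fun α => ?_) h⟩
  rw [coeff_eulerInv, norm_div, Complex.norm_natCast]
  gcongr
  rcases Nat.eq_zero_or_pos (c + α.degree) with h0 | h0
  · rw [h0]; simp
  · exact div_le_self (norm_nonneg _) (by exact_mod_cast h0)

/-! ### The homotopy of the formal de Rham complex -/

/-- The partial derivative `∂_i` on `ℂ⟦x⟧` as a linear map. -/
def formalD {n : ℕ} (i : Fin n) : MvPowerSeries (Fin n) ℂ →ₗ[ℂ] MvPowerSeries (Fin n) ℂ :=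
  (MvPowerSeries.pderiv ℂ i).toLinearMap

theorem formalD_apply {n : ℕ} (i : Fin n) (g : MvPowerSeries (Fin n) ℂ) :
    formalD i g = MvPowerSeries.pderiv ℂ i g := rfl

/-- The multiplication by the partial derivative `∂_i(f)` on `ℂ⟦x⟧`. -/
def mulD {n : ℕ} (f : MvPowerSeries (Fin n) ℂ) (i : Fin n) :
    MvPowerSeries (Fin n) ℂ →ₗ[ℂ] MvPowerSeries (Fin n) ℂ :=
  LinearMap.mulLeft ℂ (MvPowerSeries.pderiv ℂ i f)

theorem mulD_apply {n : ℕ} (f : MvPowerSeries (Fin n) ℂ) (i : Fin n)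
    (g : MvPowerSeries (Fin n) ℂ) : mulD f i g = MvPowerSeries.pderiv ℂ i f * g := rfl

/-- The exterior derivative on formal forms. -/
def formalExt {n : ℕ} {p q : ℤ} (h : p + 1 = q) :
    Form (MvPowerSeries (Fin n) ℂ) n p →ₗ[ℂ] Form (MvPowerSeries (Fin n) ℂ) n q :=
  wedgeOp formalD h

/-- The operator `ω ↦ df ∧ ω` on formal forms. -/
def formalDf {n : ℕ} (f : MvPowerSeries (Fin n) ℂ) {p q : ℤ} (h : p + 1 = q) :
    Form (MvPowerSeries (Fin n) ℂ) n p →ₗ[ℂ] Form (MvPowerSeries (Fin n) ℂ) n q :=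
  wedgeOp (mulD f) h

theorem formalDf_formalDf {n : ℕ} (f : MvPowerSeries (Fin n) ℂ) {p q r : ℤ} (h : p + 1 = q)
    (h' : q + 1 = r) (ω : Form (MvPowerSeries (Fin n) ℂ) n p) :
    formalDf f h' (formalDf f h ω) = 0 :=
  wedgeOp_wedgeOp_self (mulD f) (fun j l x => by simp only [mulD_apply]; ring) h h' ω

theorem pderiv_comm {n : ℕ} (i j : Fin n) (g : MvPowerSeries (Fin n) ℂ) :
    MvPowerSeries.pderiv ℂ i (MvPowerSeries.pderiv ℂ j g) =
      MvPowerSeries.pderiv ℂ j (MvPowerSeries.pderiv ℂ i g) := by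
  classical
  ext α
  simp only [MvPowerSeries.coeff_pderiv, Finsupp.add_apply, Finsupp.single_apply]
  rw [add_right_comm]
  by_cases h : i = j
  · subst h; rfl
  · rw [if_neg h, if_neg (Ne.symm h)]
    push_cast
    ring

theorem formalExt_formalExt {n : ℕ} {p q r : ℤ} (h : p + 1 = q)
    (h' : q + 1 = r) (ω : Form (MvPowerSeries (Fin n) ℂ) n p) :
    formalExt h' (formalExt h ω) = 0 :=
  wedgeOp_wedgeOp_self formalD (fun j l x => pderiv_comm j l x) h h' ω

theorem formalExt_formalDf {n : ℕ} (f : MvPowerSeries (Fin n) ℂ) {p q r : ℤ} (h : p + 1 = q)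
    (h' : q + 1 = r) (ω : Form (MvPowerSeries (Fin n) ℂ) n p) :
    formalExt h' (formalDf f h ω) = -formalDf f h' (formalExt h ω) := by
  refine eq_neg_of_add_eq_zero_left (wedgeOp_wedgeOp_add formalD (mulD f)
    (fun j l x => ?_) h h' ω)
  simp only [mulD_apply, formalD_apply, Derivation.leibniz, smul_eq_mul, pderiv_comm j l f]
  ring

/-- The contraction of a form with the Euler vector field. -/
def contract {n : ℕ} {p q : ℤ} (_ : p + 1 = q) (ω : Form (MvPowerSeries (Fin n) ℂ) n q) :
    Form (MvPowerSeries (Fin n) ℂ) n p := fun J =>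
  ∑ l ∈ J.1ᶜ, sgn (insert l J.1) l • (MvPowerSeries.X l * Form.coef ω (insert l J.1))

theorem coef_contract {n : ℕ} {p q : ℤ} (h : p + 1 = q) (ω : Form (MvPowerSeries (Fin n) ℂ) n q)
    {J : Finset (Fin n)} (hJ : (J.card : ℤ) = p) : Form.coef (contract h ω) J =
      ∑ l ∈ Jᶜ, sgn (insert l J) l • (MvPowerSeries.X l * Form.coef ω (insert l J)) := by
  simp [Form.coef, hJ, contract]

/-- Cartan's formula for the Euler field: the Lie derivative acts on x^α dx_I by |I| + |α|. -/
theorem formalExt_contract {n : ℕ} {p q r : ℤ} (h : p + 1 = q) (h' : q + 1 = r)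
    (ω : Form (MvPowerSeries (Fin n) ℂ) n q) (I : {I : Finset (Fin n) // (I.card : ℤ) = q}) :
    formalExt h (contract h ω) I + contract h' (formalExt h' ω) I =
      (I.1.card : ℂ) • ω I + ∑ i, MvPowerSeries.X i * MvPowerSeries.pderiv ℂ i (ω I) := by
  -- The complement of I \ {j} is Iᶜ together with j: the index l = j gives the diagonal term, the l
  -- outside I give mixed terms.
  have h1 : formalExt h (contract h ω) I =
      (∑ j ∈ I.1, (ω I + MvPowerSeries.X j * MvPowerSeries.pderiv ℂ j (ω I))) +
      ∑ j ∈ I.1, ∑ l ∈ I.1ᶜ, (sgn I.1 j * sgn (insert l (I.1.erase j)) l) •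
        (MvPowerSeries.X l * MvPowerSeries.pderiv ℂ j
          (Form.coef ω (insert l (I.1.erase j)))) := by
    rw [formalExt, wedgeOp_apply, ← Finset.sum_add_distrib]
    refine Finset.sum_congr rfl fun j hj => ?_
    have hc : ((I.1.erase j).card : ℤ) = p := by
      have := Finset.card_erase_add_one hj
      have := I.2
      omega
    rw [coef_contract h ω hc, Finset.compl_erase, Finset.sum_insert (by simpa using hj),
      Finset.insert_erase hj, Form.coef_coe]
    simp only [map_add, smul_add, map_sum, map_zsmul, Finset.smul_sum, smul_smul, sgn_mul_self,
      one_smul, formalD_apply, Derivation.leibniz,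
      smul_eq_mul, MvPowerSeries.pderiv_X_self, mul_one]
    rw [add_comm (ω I)]
    congr 1
    refine Finset.sum_congr rfl fun l hl => ?_
    have hlj : l ≠ j := by rintro rfl; simp at hl; exact hl hj
    rw [MvPowerSeries.pderiv_X_of_ne hlj]
    simp
  have h2 : contract h' (formalExt h' ω) I =
      (∑ l ∈ I.1ᶜ, MvPowerSeries.X l * MvPowerSeries.pderiv ℂ l (ω I)) +
      ∑ l ∈ I.1ᶜ, ∑ j ∈ I.1, (sgn (insert l I.1) l * sgn (insert l I.1) j) •
        (MvPowerSeries.X l * MvPowerSeries.pderiv ℂ j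
          (Form.coef ω (insert l (I.1.erase j)))) := by
    rw [contract, ← Finset.sum_add_distrib]
    refine Finset.sum_congr rfl fun l hl => ?_
    have hl' : l ∉ I.1 := by simpa using hl
    have hc : ((insert l I.1).card : ℤ) = r := by
      rw [Finset.card_insert_of_notMem hl']
      have := I.2
      push_cast
      omega
    rw [formalExt, Form.coef_wedgeOp _ h' ω hc, Finset.sum_insert hl', Finset.erase_insert hl',
      Form.coef_coe, mul_add, smul_add, Finset.mul_sum, Finset.smul_sum]
    congr 1
    · rw [mul_smul_comm, smul_smul, sgn_mul_self, one_smul]; rfl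
    · refine Finset.sum_congr rfl fun j hj => ?_
      have hlj : l ≠ j := by rintro rfl; exact hl' hj
      rw [mul_smul_comm, smul_smul, Finset.erase_insert_of_ne hlj]
      rfl
  -- The mixed terms of the two compositions carry opposite signs and cancel.
  have h3 : ∀ j ∈ I.1, ∀ l ∈ I.1ᶜ, sgn I.1 j * sgn (insert l (I.1.erase j)) l =
      -(sgn (insert l I.1) l * sgn (insert l I.1) j) := by
    intro j hj l hl
    have hl' : l ∉ I.1 := by simpa using hl
    have hlj : l ≠ j := by rintro rfl; exact hl' hj
    have h4 := sgn_mul_sgn_erase (I := insert l I.1) (Finset.mem_insert_self l _)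
      (Finset.mem_insert_of_mem hj) hlj
    rw [Finset.erase_insert hl', Finset.erase_insert_of_ne hlj] at h4
    have h5 := sgn_mul_self (insert l I.1) l
    have h6 := sgn_mul_self (insert l (I.1.erase j)) l
    calc sgn I.1 j * sgn (insert l (I.1.erase j)) l
        = sgn (insert l I.1) l * (sgn (insert l I.1) l * sgn I.1 j) *
            sgn (insert l (I.1.erase j)) l := by rw [← mul_assoc, h5, one_mul]
      _ = -(sgn (insert l I.1) l * sgn (insert l I.1) j) *
            (sgn (insert l (I.1.erase j)) l * sgn (insert l (I.1.erase j)) l) := by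
          rw [h4]; ring
      _ = _ := by rw [h6, mul_one]
  rw [h1, h2, Finset.sum_comm (s := I.1ᶜ)]
  have h7 : (∑ j ∈ I.1, ∑ l ∈ I.1ᶜ, (sgn I.1 j * sgn (insert l (I.1.erase j)) l) •
        (MvPowerSeries.X l * MvPowerSeries.pderiv ℂ j (Form.coef ω (insert l (I.1.erase j))))) =
      -∑ j ∈ I.1, ∑ l ∈ I.1ᶜ, (sgn (insert l I.1) l * sgn (insert l I.1) j) •
        (MvPowerSeries.X l * MvPowerSeries.pderiv ℂ j (Form.coef ω (insert l (I.1.erase j)))) := by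
    simp only [← Finset.sum_neg_distrib]
    refine Finset.sum_congr rfl fun j hj => Finset.sum_congr rfl fun l hl => ?_
    rw [h3 j hj l hl, neg_smul]
  rw [h7, Finset.sum_add_distrib, Finset.sum_const, ← Finset.sum_add_sum_compl I.1,
    Nat.cast_smul_eq_nsmul]
  abel

/-- The homotopy operator: divide the coefficient of `x^α dx_I` by `|I| + |α|` and contract with
the Euler vector field. -/
def homotopy {n : ℕ} {p q : ℤ} (h : p + 1 = q) :
    Form (MvPowerSeries (Fin n) ℂ) n q →ₗ[ℂ] Form (MvPowerSeries (Fin n) ℂ) n p where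
  toFun ω := contract h fun I => eulerInv n q.toNat (ω I)
  map_add' ω ω' := by
    funext J
    simp only [contract, Pi.add_apply, ← Finset.sum_add_distrib, ← smul_add, ← mul_add]
    refine Finset.sum_congr rfl fun l _ => ?_
    congr 2
    unfold Form.coef
    split_ifs <;> simp
  map_smul' a ω := by
    funext J
    simp only [contract, Pi.smul_apply, Finset.smul_sum, RingHom.id_apply]
    refine Finset.sum_congr rfl fun l _ => ?_
    rw [smul_comm a, ← mul_smul_comm a]
    congr 2
    unfold Form.coef
    split_ifs
    · exact map_smul (eulerInv n q.toNat) a _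
    · simp

theorem homotopy_apply {n : ℕ} {p q : ℤ} (h : p + 1 = q)
    (ω : Form (MvPowerSeries (Fin n) ℂ) n q) :
    homotopy h ω = contract h fun I => eulerInv n q.toNat (ω I) := rfl

theorem formalExt_homotopy {n : ℕ} {p q r : ℤ} (h : p + 1 = q) (h' : q + 1 = r) (hq : 1 ≤ q)
    (ω : Form (MvPowerSeries (Fin n) ℂ) n q) :
    formalExt h (homotopy h ω) + homotopy h' (formalExt h' ω) = ω := by
  have h1 : (fun I => eulerInv n r.toNat (formalExt h' ω I)) =
      formalExt h' fun I => eulerInv n q.toNat (ω I) := by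
    have hr : r.toNat = q.toNat + 1 := by omega
    funext I
    simp only [formalExt, wedgeOp_apply, map_sum, map_zsmul, hr]
    refine Finset.sum_congr rfl fun j _ => ?_
    rw [Form.coef_map ω _ (map_zero _)]
    congr 1
    exact (pderiv_eulerInv _ _ _).symm
  funext I
  rw [Pi.add_apply, homotopy_apply, homotopy_apply, h1, formalExt_contract]
  have h2 : I.1.card = q.toNat := by
    have := I.2
    omega
  rw [h2, euler_eulerInv _ _ (Or.inl (by omega))]

/-! ### The order filtration -/

/-- The ideal of power series of order at least `k`. -/
def ordIdeal (n k : ℕ) : Ideal (MvPowerSeries (Fin n) ℂ) where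
  carrier := {g | ∀ α : Fin n →₀ ℕ, α.degree < k → coeff α g = 0}
  add_mem' ha hb α h := by rw [map_add, ha α h, hb α h, add_zero]
  zero_mem' α _ := map_zero _
  smul_mem' c g hg α h := by
    classical
    rw [smul_eq_mul, MvPowerSeries.coeff_mul]
    refine Finset.sum_eq_zero fun x hx => ?_
    have h1 := congrArg Finsupp.degree (Finset.HasAntidiagonal.mem_antidiagonal.1 hx)
    rw [map_add] at h1
    rw [hg x.2 (by omega), mul_zero]

theorem mul_mem_ordIdeal {n a b : ℕ} {g h : MvPowerSeries (Fin n) ℂ} (hg : g ∈ ordIdeal n a)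
    (hh : h ∈ ordIdeal n b) : g * h ∈ ordIdeal n (a + b) := by
  classical
  intro α hα
  rw [MvPowerSeries.coeff_mul]
  refine Finset.sum_eq_zero fun x hx => ?_
  have h1 := congrArg Finsupp.degree (Finset.HasAntidiagonal.mem_antidiagonal.1 hx)
  rw [map_add] at h1
  rcases lt_or_ge x.1.degree a with h2 | h2
  · rw [hg x.1 h2, zero_mul]
  · rw [hh x.2 (by omega), mul_zero]

theorem ordIdeal_antitone {n a b : ℕ} (h : a ≤ b) : ordIdeal n b ≤ ordIdeal n a :=
  fun _ hg α hα => hg α (hα.trans_le h)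

theorem mem_ordIdeal_zero {n : ℕ} (g : MvPowerSeries (Fin n) ℂ) : g ∈ ordIdeal n 0 :=
  fun _ h => absurd h (Nat.not_lt_zero _)

theorem X_mem_ordIdeal {n : ℕ} (i : Fin n) :
    (MvPowerSeries.X i : MvPowerSeries (Fin n) ℂ) ∈ ordIdeal n 1 := by
  intro α h
  obtain rfl : α = 0 := (Finsupp.degree_eq_zero_iff α).1 (by omega)
  simp

theorem pderiv_mem_ordIdeal {n k : ℕ} {g : MvPowerSeries (Fin n) ℂ} (i : Fin n)
    (hg : g ∈ ordIdeal n (k + 1)) : MvPowerSeries.pderiv ℂ i g ∈ ordIdeal n k := by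
  intro α h
  rw [MvPowerSeries.coeff_pderiv, hg _ (by rw [map_add, Finsupp.degree_single]; omega), zero_mul]

theorem eulerInv_mem_ordIdeal {n k : ℕ} {g : MvPowerSeries (Fin n) ℂ} (c : ℕ)
    (hg : g ∈ ordIdeal n k) : eulerInv n c g ∈ ordIdeal n k := by
  intro α h
  rw [coeff_eulerInv, hg α h, zero_div]

/-- A power series without constant term is a combination of the variables. -/
theorem eq_sum_X_mul {n : ℕ} {g : MvPowerSeries (Fin n) ℂ} (hg : g ∈ ordIdeal n 1) :
    g = ∑ i, MvPowerSeries.X i * MvPowerSeries.pderiv ℂ i (eulerInv n 0 g) := by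
  conv_lhs => rw [← euler_eulerInv 0 g (Or.inr (hg 0 (by simp)))]
  simp

theorem formalIdeal_pow {n : ℕ} (k : ℕ) : formalIdeal n ^ k = ordIdeal n k := by
  refine le_antisymm ?_ ?_
  · induction k with
    | zero => exact fun g _ => mem_ordIdeal_zero g
    | succ k ih =>
      rw [pow_succ]
      refine Ideal.mul_le.2 fun a ha b hb => mul_mem_ordIdeal (ih ha) ?_
      exact (Ideal.span_le (I := ordIdeal n 1)).2
        (by rintro _ ⟨i, rfl⟩; exact X_mem_ordIdeal i) hb
  · induction k with
    | zero => simp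
    | succ k ih =>
      intro g hg
      rw [eq_sum_X_mul (ordIdeal_antitone (Nat.le_add_left 1 k) hg), pow_succ']
      exact Ideal.sum_mem _ fun i _ => Ideal.mul_mem_mul (Ideal.subset_span ⟨i, rfl⟩)
        (ih (pderiv_mem_ordIdeal i (eulerInv_mem_ordIdeal 0 hg)))

theorem mem_convIdeal_pow {n k : ℕ} {g : Conv n} :
    g ∈ convIdeal n ^ k ↔ (g : MvPowerSeries (Fin n) ℂ) ∈ ordIdeal n k := by
  constructor
  · intro hg
    suffices h : convIdeal n ^ k ≤ (ordIdeal n k).comap (Conv n).val from h hg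
    clear hg
    induction k with
    | zero => exact fun g _ => mem_ordIdeal_zero _
    | succ k ih =>
      rw [pow_succ]
      refine Ideal.mul_le.2 fun a ha b hb => ?_
      have h1 : convIdeal n ≤ (ordIdeal n 1).comap (Conv n).val :=
        Ideal.span_le.2 (by rintro _ ⟨i, rfl⟩; exact X_mem_ordIdeal i)
      exact mul_mem_ordIdeal (ih ha) (h1 hb)
  · induction k generalizing g with
    | zero => simp
    | succ k ih =>
      intro hg
      have h1 : g = ∑ i, convX i * (⟨MvPowerSeries.pderiv ℂ i (eulerInv n 0 g),
          (IsConvergent.eulerInv 0 g.2).pderiv i⟩ : Conv n) := by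
        apply Subtype.ext
        conv_lhs => rw [eq_sum_X_mul (ordIdeal_antitone (Nat.le_add_left 1 k) hg)]
        rw [AddSubmonoidClass.coe_finsetSum]
        rfl
      rw [h1, pow_succ']
      exact Ideal.sum_mem _ fun i _ => Ideal.mul_mem_mul (Ideal.subset_span ⟨i, rfl⟩)
        (ih (pderiv_mem_ordIdeal i (eulerInv_mem_ordIdeal 0 hg)))

theorem mem_ideal_smul_top_pi {R ι : Type*} [CommRing R] [Finite ι] (J : Ideal R) (x : ι → R) :
    x ∈ J • (⊤ : Submodule R (ι → R)) ↔ ∀ i, x i ∈ J := by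
  classical
  cases nonempty_fintype ι
  constructor
  · intro hx i
    refine Submodule.smul_induction_on hx (fun r hr y _ => ?_) fun y z hy hz => ?_
    · exact J.mul_mem_right _ hr
    · exact J.add_mem hy hz
  · intro hx
    rw [pi_eq_sum_univ' x]
    exact Submodule.sum_mem _ fun i _ => Submodule.smul_mem_smul (hx i) trivial

/-- The formal forms whose coefficients have order at least `k`. -/
def ordForm (n k : ℕ) (p : ℤ) : Submodule ℂ (Form (MvPowerSeries (Fin n) ℂ) n p) where
  carrier := {ω | ∀ I, ω I ∈ ordIdeal n k}
  add_mem' ha hb I := (ordIdeal n k).add_mem (ha I) (hb I)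
  zero_mem' _ := (ordIdeal n k).zero_mem
  smul_mem' c _ h I := ((ordIdeal n k).restrictScalars ℂ).smul_mem c (h I)

theorem mem_ordForm_zero {n : ℕ} {p : ℤ} (ω : Form (MvPowerSeries (Fin n) ℂ) n p) :
    ω ∈ ordForm n 0 p := fun I => mem_ordIdeal_zero (ω I)

theorem ordForm_antitone {n a b : ℕ} {p : ℤ} (h : a ≤ b) : ordForm n b p ≤ ordForm n a p :=
  fun _ hω I => ordIdeal_antitone h (hω I)

theorem coef_mem_ordIdeal {n k : ℕ} {p : ℤ} {ω : Form (MvPowerSeries (Fin n) ℂ) n p}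
    (hω : ω ∈ ordForm n k p) (J : Finset (Fin n)) : Form.coef ω J ∈ ordIdeal n k := by
  unfold Form.coef
  split_ifs
  · exact hω _
  · exact Ideal.zero_mem _

theorem eq_zero_of_mem_ordForm {n : ℕ} {p : ℤ} {ω : Form (MvPowerSeries (Fin n) ℂ) n p}
    (h : ∀ k, ω ∈ ordForm n k p) : ω = 0 := by
  funext I
  ext α
  exact h (α.degree + 1) I α (Nat.lt_succ_self _)

/-- The filtration by order is complete. -/
theorem exists_limit {n : ℕ} {p : ℤ} (S : ℕ → Form (MvPowerSeries (Fin n) ℂ) n p)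
    (hS : ∀ k, S (k + 1) - S k ∈ ordForm n k p) : ∃ A, ∀ k, A - S k ∈ ordForm n k p := by
  have h1 : ∀ k m, k ≤ m → S m - S k ∈ ordForm n k p := by
    intro k m hkm
    induction m, hkm using Nat.le_induction with
    | base => rw [sub_self]; exact Submodule.zero_mem _
    | succ m hm ih =>
      rw [← sub_add_sub_cancel _ (S m)]
      exact Submodule.add_mem _ (ordForm_antitone hm (hS m)) ih
  -- The coefficient of x^α no longer changes from the index |α| + 1 on.
  let A : Form (MvPowerSeries (Fin n) ℂ) n p := fun I α => coeff α (S (α.degree + 1) I)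
  refine ⟨A, fun k I α hα => ?_⟩
  have h2 : coeff α (A I) = coeff α (S (α.degree + 1) I) := rfl
  have h3 : coeff α (S k I - S (α.degree + 1) I) = 0 :=
    h1 _ k hα I α (Nat.lt_succ_self _)
  rw [map_sub, sub_eq_zero] at h3
  rw [Pi.sub_apply, map_sub, h2, h3, sub_self]

theorem wedgeOp_mem_ordForm {n k k' : ℕ}
    {T : Fin n → MvPowerSeries (Fin n) ℂ →ₗ[ℂ] MvPowerSeries (Fin n) ℂ}
    (hT : ∀ i g, g ∈ ordIdeal n k → T i g ∈ ordIdeal n k') {p q : ℤ} (h : p + 1 = q)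
    {ω : Form (MvPowerSeries (Fin n) ℂ) n p} (hω : ω ∈ ordForm n k p) :
    wedgeOp T h ω ∈ ordForm n k' q := by
  intro I
  rw [wedgeOp_apply]
  exact Ideal.sum_mem _ fun j _ => zsmul_mem (hT j _ (coef_mem_ordIdeal hω _)) _

theorem formalExt_mem_ordForm {n k : ℕ} {p q : ℤ} (h : p + 1 = q)
    {ω : Form (MvPowerSeries (Fin n) ℂ) n p} (hω : ω ∈ ordForm n (k + 1) p) :
    formalExt h ω ∈ ordForm n k q :=
  wedgeOp_mem_ordForm (fun i _ hg => pderiv_mem_ordIdeal i hg) h hω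

theorem formalDf_mem_ordForm {n k : ℕ} {f : MvPowerSeries (Fin n) ℂ}
    (hf : ∀ i, MvPowerSeries.pderiv ℂ i f ∈ ordIdeal n 1) {p q : ℤ} (h : p + 1 = q)
    {ω : Form (MvPowerSeries (Fin n) ℂ) n p} (hω : ω ∈ ordForm n k p) :
    formalDf f h ω ∈ ordForm n (k + 1) q :=
  wedgeOp_mem_ordForm (fun i _ hg => by
    rw [mulD_apply, add_comm]; exact mul_mem_ordIdeal (hf i) hg) h hω

theorem homotopy_mem_ordForm {n k : ℕ} {p q : ℤ} (h : p + 1 = q)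
    {ω : Form (MvPowerSeries (Fin n) ℂ) n q} (hω : ω ∈ ordForm n k q) :
    homotopy h ω ∈ ordForm n k p := by
  intro J
  rw [homotopy_apply, contract]
  refine Ideal.sum_mem _ fun l _ => zsmul_mem (Ideal.mul_mem_left _ _ ?_) _
  exact coef_mem_ordIdeal (fun I => eulerInv_mem_ordIdeal _ (hω I)) _

/-! ### Linear compactness -/

/-- A system of linear equations, each involving finitely many unknowns, is solvable if every
finite subsystem is. -/
theorem exists_solution {A B : Type*} (D : (A → ℂ) →ₗ[ℂ] (B → ℂ))
    (hD : ∀ b, ∃ S : Finset A, ∀ v, (∀ a ∈ S, v a = 0) → D v b = 0) (w : B → ℂ)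
    (hw : ∀ S : Finset B, ∃ v, ∀ b ∈ S, D v b = w b) : ∃ v, D v = w := by
  classical
  -- Each equation is a finitely supported functional, that is, an element of A →₀ ℂ.
  have h1 : ∀ b, ∃ ℓ : A →₀ ℂ, ∀ v, D v b = Finsupp.linearCombination ℂ v ℓ := by
    intro b
    obtain ⟨S, hS⟩ := hD b
    refine ⟨∑ a ∈ S, Finsupp.single a (D (Pi.single a 1) b), fun v => ?_⟩
    have h2 : D (v - ∑ a ∈ S, v a • Pi.single a 1) b = 0 := by
      refine hS _ fun a ha => ?_
      simp [Finset.sum_apply, Pi.single_apply, ha]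
    rw [map_sub, Pi.sub_apply, sub_eq_zero] at h2
    rw [h2, map_sum, map_sum, Finset.sum_apply]
    refine Finset.sum_congr rfl fun a _ => ?_
    rw [map_smul, Pi.smul_apply, Finsupp.linearCombination_single, smul_eq_mul, smul_eq_mul,
      mul_comm]
  choose ℓ hℓ using h1
  let φ := Finsupp.linearCombination ℂ ℓ
  let ψ := Finsupp.linearCombination ℂ w
  -- The assignment ℓ_b ↦ w_b is consistent if `ψ` kills every relation among the ℓ_b. A relation
  -- involves finitely many equations, and a common solution of those makes it vanish.
  have hker : ψ ∈ (LinearMap.ker φ).dualAnnihilator := by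
    rw [Submodule.mem_dualAnnihilator]
    intro c hc
    obtain ⟨v, hv⟩ := hw c.support
    have h3 : ψ c = Finsupp.linearCombination ℂ v (φ c) := by
      simp only [ψ, φ]
      rw [Finsupp.linearCombination_apply (R := ℂ) (v := w) (l := c),
        Finsupp.linearCombination_apply (R := ℂ) (v := ℓ) (l := c), Finsupp.sum, Finsupp.sum, map_sum]
      refine Finset.sum_congr rfl fun b hb => ?_
      rw [map_smul, ← hℓ, hv b hb]
    rw [h3, LinearMap.mem_ker.1 hc, map_zero]
  rw [← LinearMap.range_dualMap_eq_dualAnnihilator_ker] at hker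
  obtain ⟨g, hg⟩ := hker
  -- A functional on A →₀ ℂ with g ∘ φ = ψ is the same as a vector of A → ℂ; this vector solves the
  -- system.
  refine ⟨fun a => g (Finsupp.single a 1), funext fun b => ?_⟩
  have h4 : Finsupp.linearCombination ℂ (fun a => g (Finsupp.single a 1)) = g := by
    ext a
    simp
  have h5 := LinearMap.congr_fun hg (Finsupp.single b 1)
  rw [hℓ, h4]
  simpa [φ, ψ] using h5

/-- The image of a continuous operator on formal forms is closed. -/
theorem mem_range_of_forall_ordForm {n : ℕ} {p q : ℤ}
    (D : Form (MvPowerSeries (Fin n) ℂ) n p →ₗ[ℂ] Form (MvPowerSeries (Fin n) ℂ) n q)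
    (hD : ∀ k, ∃ m, ∀ ξ ∈ ordForm n m p, D ξ ∈ ordForm n k q)
    {ω : Form (MvPowerSeries (Fin n) ℂ) n q} (hω : ∀ k, ∃ ξ, ω - D ξ ∈ ordForm n k q) :
    ω ∈ LinearMap.range D := by
  classical
  let A := {I : Finset (Fin n) // (I.card : ℤ) = p} × (Fin n →₀ ℕ)
  let B := {I : Finset (Fin n) // (I.card : ℤ) = q} × (Fin n →₀ ℕ)
  let mk : (A → ℂ) →ₗ[ℂ] Form (MvPowerSeries (Fin n) ℂ) n p :=
    { toFun := fun v I α => v (I, α)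
      map_add' := fun _ _ => rfl
      map_smul' := fun _ _ => rfl }
  let co : Form (MvPowerSeries (Fin n) ℂ) n q →ₗ[ℂ] (B → ℂ) :=
    LinearMap.pi fun b => coeff b.2 ∘ₗ LinearMap.proj b.1
  have hco : ∀ (η : Form (MvPowerSeries (Fin n) ℂ) n q) b, co η b = coeff b.2 (η b.1) :=
    fun _ _ => rfl
  have hmk : ∀ (v : A → ℂ) I α, coeff α (mk v I) = v (I, α) := fun _ _ _ => rfl
  -- By continuity each coefficient of D ξ depends only on coefficients of ξ of bounded degree, of
  -- which there are finitely many. A finite subsystem is solved by approximating ω beyond the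
  -- largest degree that occurs in it.
  obtain ⟨v, hv⟩ := exists_solution (co ∘ₗ D ∘ₗ mk) (fun b => by
      obtain ⟨m, hm⟩ := hD (b.2.degree + 1)
      refine ⟨Finset.univ ×ˢ (Finsupp.finite_of_degree_lt (σ := Fin n) m).toFinset,
        fun v hv => ?_⟩
      refine hm (mk v) (fun I α hα => ?_) b.1 b.2 (Nat.lt_succ_self _)
      rw [hmk]
      exact hv (I, α) (Finset.mem_product.2 ⟨Finset.mem_univ _, by simpa using hα⟩)) (co ω) (fun S => by
      obtain ⟨ξ, hξ⟩ := hω (S.sup (fun b => b.2.degree) + 1)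
      refine ⟨fun a => coeff a.2 (ξ a.1), fun b hb => ?_⟩
      have h1 : mk (fun a => coeff a.2 (ξ a.1)) = ξ := rfl
      have h2 := hξ b.1 b.2 (Nat.lt_succ_of_le (Finset.le_sup (f := fun b : B => b.2.degree) hb))
      rw [Pi.sub_apply, map_sub, sub_eq_zero] at h2
      rw [LinearMap.comp_apply, LinearMap.comp_apply, h1, hco, hco, h2])
  refine ⟨mk v, ?_⟩
  funext I
  ext α
  exact congrFun hv (I, α)

/-! ### The operator `s` on formal top forms -/

instance subsingleton_form_succ {R : Type*} (n : ℕ) :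
    Subsingleton (Form R n ((n : ℤ) + 1)) := by
  refine ⟨fun ω ω' => funext fun I => ?_⟩
  have h1 := I.2
  have h2 := Finset.card_le_univ I.1
  rw [Fintype.card_fin] at h2
  omega

theorem formalExt_homotopy_top {n : ℕ} (hn : 1 ≤ n)
    (ω : Form (MvPowerSeries (Fin n) ℂ) n (n : ℤ)) :
    formalExt (sub_add_cancel (n : ℤ) 1) (homotopy (sub_add_cancel (n : ℤ) 1) ω) = ω := by
  have h := formalExt_homotopy (sub_add_cancel (n : ℤ) 1) (rfl : (n : ℤ) + 1 = n + 1)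
    (by exact_mod_cast hn) ω
  rwa [Subsingleton.elim (formalExt rfl ω) 0, map_zero, add_zero] at h

/-- The subspace `df ∧ dΩ̂^{n-2}` of `Ω̂^n`. -/
def formalExactPart {n : ℕ} (f : MvPowerSeries (Fin n) ℂ) :
    Submodule ℂ (Form (MvPowerSeries (Fin n) ℂ) n (n : ℤ)) :=
  LinearMap.range (formalDf f (sub_add_cancel (n : ℤ) 1) ∘ₗ
    formalExt (show (n : ℤ) - 2 + 1 = n - 1 by ring))

theorem mem_formalExactPart {n : ℕ} {f : MvPowerSeries (Fin n) ℂ}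
    {ω : Form (MvPowerSeries (Fin n) ℂ) n (n : ℤ)} : ω ∈ formalExactPart f ↔
      ∃ ξ, formalDf f (sub_add_cancel (n : ℤ) 1)
        (formalExt (show (n : ℤ) - 2 + 1 = n - 1 by ring) ξ) = ω := Iff.rfl

theorem mem_formalExactPart_of_forall {n : ℕ} {f : MvPowerSeries (Fin n) ℂ}
    (hf : ∀ i, MvPowerSeries.pderiv ℂ i f ∈ ordIdeal n 1)
    {ω : Form (MvPowerSeries (Fin n) ℂ) n (n : ℤ)}
    (h : ∀ k, ∃ ℓ ∈ formalExactPart f, ω - ℓ ∈ ordForm n k (n : ℤ)) : ω ∈ formalExactPart f := by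
  refine mem_range_of_forall_ordForm _ (fun k => ⟨k + 1, fun ξ hξ => ?_⟩) fun k => ?_
  · exact ordForm_antitone (Nat.le_succ k)
      (formalDf_mem_ordForm hf _ (formalExt_mem_ordForm _ hξ))
  · obtain ⟨_, ⟨ξ, rfl⟩, h2⟩ := h k
    exact ⟨ξ, h2⟩

/-- The operator `dη ↦ df ∧ η` on formal top forms, for a chosen primitive `η`. -/
def sOp {n : ℕ} (f : MvPowerSeries (Fin n) ℂ) :
    Form (MvPowerSeries (Fin n) ℂ) n (n : ℤ) →ₗ[ℂ] Form (MvPowerSeries (Fin n) ℂ) n (n : ℤ) :=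
  formalDf f (sub_add_cancel (n : ℤ) 1) ∘ₗ homotopy (sub_add_cancel (n : ℤ) 1)

theorem sOp_apply {n : ℕ} (f : MvPowerSeries (Fin n) ℂ)
    (ω : Form (MvPowerSeries (Fin n) ℂ) n (n : ℤ)) : sOp f ω =
      formalDf f (sub_add_cancel (n : ℤ) 1) (homotopy (sub_add_cancel (n : ℤ) 1) ω) := rfl

theorem sOp_mem_ordForm {n k : ℕ} {f : MvPowerSeries (Fin n) ℂ}
    (hf : ∀ i, MvPowerSeries.pderiv ℂ i f ∈ ordIdeal n 1)
    {ω : Form (MvPowerSeries (Fin n) ℂ) n (n : ℤ)} (hω : ω ∈ ordForm n k (n : ℤ)) :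
    sOp f ω ∈ ordForm n (k + 1) (n : ℤ) :=
  formalDf_mem_ordForm hf _ (homotopy_mem_ordForm _ hω)

/-- η and h(dη) are primitives of the same form and differ by d(hη). The homotopy formula is applied
in degree n - 1, which must be at least 1, hence n ≥ 2. -/
theorem formalDf_sub_sOp_mem {n : ℕ} (hn : 2 ≤ n) (f : MvPowerSeries (Fin n) ℂ)
    (η : Form (MvPowerSeries (Fin n) ℂ) n ((n : ℤ) - 1)) :
    formalDf f (sub_add_cancel (n : ℤ) 1) η - sOp f (formalExt (sub_add_cancel (n : ℤ) 1) η) ∈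
      formalExactPart f := by
  have h := formalExt_homotopy (show (n : ℤ) - 2 + 1 = n - 1 by ring) (sub_add_cancel (n : ℤ) 1)
    (by omega) η
  refine ⟨homotopy (show (n : ℤ) - 2 + 1 = n - 1 by ring) η, ?_⟩
  rw [LinearMap.comp_apply, sOp_apply, ← map_sub, eq_sub_of_add_eq h]

/-- Apply the comparison of primitives to η = df ∧ ξ: here df ∧ η = 0 and dη = -df ∧ dξ. -/
theorem sOp_mem_formalExactPart {n : ℕ} (hn : 2 ≤ n) (f : MvPowerSeries (Fin n) ℂ)
    {ω : Form (MvPowerSeries (Fin n) ℂ) n (n : ℤ)} (hω : ω ∈ formalExactPart f) :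
    sOp f ω ∈ formalExactPart f := by
  obtain ⟨ξ, rfl⟩ := mem_formalExactPart.1 hω
  have h := formalDf_sub_sOp_mem hn f (formalDf f (show (n : ℤ) - 2 + 1 = n - 1 by ring) ξ)
  rwa [formalDf_formalDf, formalExt_formalDf, map_neg, zero_sub, neg_neg] at h

/-! ### Forms with coefficients in `ℂ⟦x⟧⟦s⟧` -/

/-- The coefficient of `s^m` of a form with coefficients in `ℂ⟦x⟧⟦s⟧`. -/
def coeffForm {n : ℕ} {p : ℤ} (m : ℕ) : FormS n p →+ Form (MvPowerSeries (Fin n) ℂ) n p where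
  toFun ω I := PowerSeries.coeff m (ω I)
  map_zero' := by funext I; simp
  map_add' _ _ := by funext I; simp

theorem coeffForm_apply {n : ℕ} {p : ℤ} (m : ℕ) (ω : FormS n p)
    (I : {I : Finset (Fin n) // (I.card : ℤ) = p}) :
    coeffForm m ω I = PowerSeries.coeff m (ω I) := rfl

theorem formS_ext {n : ℕ} {p : ℤ} {ω ω' : FormS n p}
    (h : ∀ m, coeffForm m ω = coeffForm m ω') : ω = ω' := by
  funext I
  ext1 m
  exact congrFun (h m) I

/-- The form `∑_m s^m a_m`. -/
def mkForm {n : ℕ} {p : ℤ} (a : ℕ → Form (MvPowerSeries (Fin n) ℂ) n p) : FormS n p :=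
  fun I => PowerSeries.mk fun m => a m I

theorem coeffForm_mkForm {n : ℕ} {p : ℤ} (a : ℕ → Form (MvPowerSeries (Fin n) ℂ) n p) (m : ℕ) :
    coeffForm m (mkForm a) = a m := by
  funext I
  rw [coeffForm_apply, mkForm, PowerSeries.coeff_mk]

theorem coeffForm_zero_constForm {n : ℕ} (ω : Form (MvPowerSeries (Fin n) ℂ) n (n : ℤ)) :
    coeffForm 0 (constForm ω) = ω := by
  funext I
  rw [coeffForm_apply, constForm, PowerSeries.coeff_zero_C]

theorem coeffForm_succ_constForm {n : ℕ} (ω : Form (MvPowerSeries (Fin n) ℂ) n (n : ℤ)) (m : ℕ) :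
    coeffForm (m + 1) (constForm ω) = 0 := by
  funext I
  rw [coeffForm_apply, constForm, PowerSeries.coeff_succ_C, Pi.zero_apply]

theorem X_smul_eq {n : ℕ} (g : PowerSeries (MvPowerSeries (Fin n) ℂ)) :
    (PowerSeries.X : PowerSeries ℂ) • g = PowerSeries.X * g := by
  rw [Algebra.smul_def]
  congr 1
  exact PowerSeries.map_X _

theorem C_smul_eq {n : ℕ} (a : ℂ) (g : PowerSeries (MvPowerSeries (Fin n) ℂ)) :
    (PowerSeries.C a : PowerSeries ℂ) • g = PowerSeries.C (MvPowerSeries.C a) * g := by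
  rw [Algebra.smul_def]
  congr 1
  exact PowerSeries.map_C _ _

theorem coeffForm_zero_X_smul {n : ℕ} {p : ℤ} (ω : FormS n p) :
    coeffForm 0 ((PowerSeries.X : PowerSeries ℂ) • ω) = 0 := by
  funext I
  rw [coeffForm_apply, Pi.smul_apply, X_smul_eq, PowerSeries.coeff_zero_X_mul, Pi.zero_apply]

theorem coeffForm_succ_X_smul {n : ℕ} {p : ℤ} (ω : FormS n p) (m : ℕ) :
    coeffForm (m + 1) ((PowerSeries.X : PowerSeries ℂ) • ω) = coeffForm m ω := by
  funext I
  rw [coeffForm_apply, Pi.smul_apply, X_smul_eq, PowerSeries.coeff_succ_X_mul, coeffForm_apply]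

theorem constForm_smul {n : ℕ} (a : ℂ) (ω : Form (MvPowerSeries (Fin n) ℂ) n (n : ℤ)) :
    (PowerSeries.C a : PowerSeries ℂ) • constForm ω = constForm (a • ω) := by
  funext I
  rw [Pi.smul_apply, C_smul_eq, constForm, constForm, ← map_mul, Pi.smul_apply,
    MvPowerSeries.smul_eq_C_mul]

theorem constForm_add {n : ℕ} (ω ω' : Form (MvPowerSeries (Fin n) ℂ) n (n : ℤ)) :
    constForm (ω + ω') = constForm ω + constForm ω' := by
  funext I
  exact map_add PowerSeries.C _ _

theorem coeffForm_wedge {n : ℕ} (f : MvPowerSeries (Fin n) ℂ) {p q : ℤ} (h : p + 1 = q)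
    (η : FormS n p) (m : ℕ) : coeffForm m (wedge (PowerSeries ℂ)
      (fun j => PowerSeries.C (MvPowerSeries.pderiv ℂ j f)) h η) = formalDf f h (coeffForm m η) :=
  map_wedgeOp _ (mulD f) (PowerSeries.coeff m).toAddMonoidHom
    (fun j x => PowerSeries.coeff_C_mul m x (MvPowerSeries.pderiv ℂ j f)) h η

theorem coeffForm_wedgeOp_seriesD {n : ℕ} {p q : ℤ} (h : p + 1 = q)
    (η : FormS n p) (m : ℕ) :
    coeffForm m (wedgeOp seriesD h η) = formalExt h (coeffForm m η) :=
  map_wedgeOp seriesD formalD (PowerSeries.coeff m).toAddMonoidHom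
    (fun j x => PowerSeries.coeff_mk m fun k =>
      MvPowerSeries.pderiv ℂ j (PowerSeries.coeff k x)) h η

theorem coeffForm_zero_twistedD {n : ℕ} (f : Conv n) (η : FormS n ((n : ℤ) - 1)) :
    coeffForm 0 (twistedD f η) =
      formalDf (f : MvPowerSeries (Fin n) ℂ) (sub_add_cancel (n : ℤ) 1) (coeffForm 0 η) := by
  rw [twistedD, LinearMap.sub_apply, map_sub, coeffForm_wedge, LinearMap.smul_apply,
    coeffForm_zero_X_smul, sub_zero]

theorem coeffForm_succ_twistedD {n : ℕ} (f : Conv n) (η : FormS n ((n : ℤ) - 1)) (m : ℕ) :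
    coeffForm (m + 1) (twistedD f η) =
      formalDf (f : MvPowerSeries (Fin n) ℂ) (sub_add_cancel (n : ℤ) 1) (coeffForm (m + 1) η) -
        formalExt (sub_add_cancel (n : ℤ) 1) (coeffForm m η) := by
  rw [twistedD, LinearMap.sub_apply, map_sub, coeffForm_wedge, LinearMap.smul_apply,
    coeffForm_succ_X_smul, coeffForm_wedgeOp_seriesD]

/-! ### The map from formal top forms to the twisted quotient -/

/-- The map `ω ↦ [ω]`. -/
def toTwisted {n : ℕ} (f : Conv n) :
    Form (MvPowerSeries (Fin n) ℂ) n (n : ℤ) →+ TwistedQuotient f where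
  toFun ω := (LinearMap.range (twistedD f)).mkQ (constForm ω)
  map_zero' := by
    rw [show constForm (0 : Form (MvPowerSeries (Fin n) ℂ) n (n : ℤ)) = 0 from
      funext fun _ => map_zero _, map_zero]
  map_add' ω ω' := by rw [constForm_add, map_add]

theorem toTwisted_apply {n : ℕ} (f : Conv n) (ω : Form (MvPowerSeries (Fin n) ℂ) n (n : ℤ)) :
    toTwisted f ω = (LinearMap.range (twistedD f)).mkQ (constForm ω) := rfl

theorem C_smul_toTwisted {n : ℕ} (f : Conv n) (a : ℂ)
    (ω : Form (MvPowerSeries (Fin n) ℂ) n (n : ℤ)) :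
    (PowerSeries.C a : PowerSeries ℂ) • toTwisted f ω = toTwisted f (a • ω) := by
  rw [toTwisted_apply, toTwisted_apply, ← constForm_smul, map_smul]

theorem X_smul_toTwisted_formalExt {n : ℕ} (f : Conv n)
    (η : Form (MvPowerSeries (Fin n) ℂ) n ((n : ℤ) - 1)) :
    (PowerSeries.X : PowerSeries ℂ) •
        toTwisted f (formalExt (sub_add_cancel (n : ℤ) 1) η) =
      toTwisted f (formalDf (f : MvPowerSeries (Fin n) ℂ) (sub_add_cancel (n : ℤ) 1) η) := by
  rw [toTwisted_apply, toTwisted_apply, ← map_smul, Submodule.mkQ_apply, Submodule.mkQ_apply,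
    Submodule.Quotient.eq]
  -- (df - s d)(-η) = s dη - df ∧ η.
  refine ⟨mkForm fun m => if m = 0 then -η else 0, formS_ext fun m => ?_⟩
  rcases m with _ | m
  · rw [coeffForm_zero_twistedD, coeffForm_mkForm, map_sub, coeffForm_zero_X_smul,
      coeffForm_zero_constForm, if_pos rfl, map_neg, zero_sub]
  · rw [coeffForm_succ_twistedD, coeffForm_mkForm, coeffForm_mkForm, map_sub,
      coeffForm_succ_X_smul, coeffForm_succ_constForm, if_neg (Nat.succ_ne_zero m), map_zero,
      zero_sub, sub_zero]
    rcases m with _ | m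
    · rw [if_pos rfl, map_neg, neg_neg, coeffForm_zero_constForm]
    · rw [if_neg (Nat.succ_ne_zero m), map_zero, neg_zero, coeffForm_succ_constForm]

theorem X_smul_toTwisted {n : ℕ} (hn : 1 ≤ n) (f : Conv n)
    (ω : Form (MvPowerSeries (Fin n) ℂ) n (n : ℤ)) :
    (PowerSeries.X : PowerSeries ℂ) • toTwisted f ω =
      toTwisted f (sOp (f : MvPowerSeries (Fin n) ℂ) ω) := by
  rw [sOp_apply, ← X_smul_toTwisted_formalExt, formalExt_homotopy_top hn]

/-- The class of df ∧ dξ is s times the class of d(dξ) = 0. -/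
theorem toTwisted_eq_zero_of_mem {n : ℕ} (f : Conv n)
    {ω : Form (MvPowerSeries (Fin n) ℂ) n (n : ℤ)}
    (hω : ω ∈ formalExactPart (f : MvPowerSeries (Fin n) ℂ)) : toTwisted f ω = 0 := by
  obtain ⟨ξ, rfl⟩ := mem_formalExactPart.1 hω
  rw [← X_smul_toTwisted_formalExt, formalExt_formalExt, map_zero, smul_zero]

/-- Comparing powers of s gives df ∧ η_{m+1} = dη_m, so df ∧ η_m agrees with S(df ∧ η_{m+1}) modulo
df ∧ dΩ̂^{n-2}. Each use of S gains one order, and this subspace is closed. -/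
theorem mem_of_toTwisted_eq_zero {n : ℕ} (hn : 2 ≤ n) {f : Conv n}
    (hf : ∀ i, MvPowerSeries.pderiv ℂ i (f : MvPowerSeries (Fin n) ℂ) ∈ ordIdeal n 1)
    {ω : Form (MvPowerSeries (Fin n) ℂ) n (n : ℤ)} (h : toTwisted f ω = 0) :
    ω ∈ formalExactPart (f : MvPowerSeries (Fin n) ℂ) := by
  rw [toTwisted_apply, Submodule.mkQ_apply, Submodule.Quotient.mk_eq_zero] at h
  obtain ⟨η, hη⟩ := h
  have h0 := congrArg (coeffForm 0) hη
  rw [coeffForm_zero_twistedD, coeffForm_zero_constForm] at h0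
  have h1 : ∀ m, formalDf (f : MvPowerSeries (Fin n) ℂ) (sub_add_cancel (n : ℤ) 1)
      (coeffForm (m + 1) η) = formalExt (sub_add_cancel (n : ℤ) 1) (coeffForm m η) := fun m => by
    have := congrArg (coeffForm (m + 1)) hη
    rwa [coeffForm_succ_twistedD, coeffForm_succ_constForm, sub_eq_zero] at this
  rw [← h0]
  refine mem_formalExactPart_of_forall hf fun k => ?_
  -- The induction on the order k must run over all m at once, since order k + 1 at m comes from
  -- order k at m + 1.
  suffices ∀ k m, ∃ ℓ ∈ formalExactPart (f : MvPowerSeries (Fin n) ℂ),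
      formalDf (f : MvPowerSeries (Fin n) ℂ) (sub_add_cancel (n : ℤ) 1) (coeffForm m η) - ℓ ∈
        ordForm n k (n : ℤ) from this k 0
  intro k
  induction k with
  | zero => exact fun m => ⟨0, Submodule.zero_mem _, mem_ordForm_zero _⟩
  | succ k ih =>
    intro m
    obtain ⟨ℓ, hℓ, hk⟩ := ih (m + 1)
    have h2 := formalDf_sub_sOp_mem hn (f : MvPowerSeries (Fin n) ℂ) (coeffForm m η)
    rw [← h1] at h2
    refine ⟨_, Submodule.add_mem _ h2 (sOp_mem_formalExactPart hn _ hℓ), ?_⟩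
    have h3 := sOp_mem_ordForm hf hk
    rw [map_sub] at h3
    convert h3 using 1
    abel

/-- The solution is A_j = ∑_i S^i(v_{j+i}), convergent because S raises the order. Here `S N j` is
the partial sum of its first N terms. -/
theorem exists_eq_add_sOp {n : ℕ} {f : MvPowerSeries (Fin n) ℂ}
    (hf : ∀ i, MvPowerSeries.pderiv ℂ i f ∈ ordIdeal n 1)
    (v : ℕ → Form (MvPowerSeries (Fin n) ℂ) n (n : ℤ)) :
    ∃ A : ℕ → Form (MvPowerSeries (Fin n) ℂ) n (n : ℤ), ∀ j, A j = v j + sOp f (A (j + 1)) := by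
  let S : ℕ → ℕ → Form (MvPowerSeries (Fin n) ℂ) n (n : ℤ) := fun N =>
    Nat.rec (fun _ => 0) (fun _ s j => v j + sOp f (s (j + 1))) N
  have hS : ∀ N j, S (N + 1) j = v j + sOp f (S N (j + 1)) := fun _ _ => rfl
  have h1 : ∀ N j, S (N + 1) j - S N j ∈ ordForm n N (n : ℤ) := by
    intro N
    induction N with
    | zero => exact fun j => mem_ordForm_zero _
    | succ N ih =>
      intro j
      rw [hS (N + 1), hS N, add_sub_add_left_eq_sub, ← map_sub]
      exact sOp_mem_ordForm hf (ih (j + 1))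
  choose A hA using fun j => exists_limit (fun N => S N j) fun N => h1 N j
  refine ⟨A, fun j => sub_eq_zero.1 (eq_zero_of_mem_ordForm fun k => ?_)⟩
  have h2 := hA j (k + 1)
  have h3 := sOp_mem_ordForm hf (hA (j + 1) k)
  have h4 := Submodule.sub_mem _ h2 h3
  rw [hS, map_sub] at h4
  refine ordForm_antitone (Nat.le_succ k) ?_
  convert h4 using 1
  abel

/-- Since s acts through S, the class of ∑ s^m v_m is that of A_0 = ∑ S^m(v_m). -/
theorem toTwisted_surjective {n : ℕ} (hn : 1 ≤ n) {f : Conv n}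
    (hf : ∀ i, MvPowerSeries.pderiv ℂ i (f : MvPowerSeries (Fin n) ℂ) ∈ ordIdeal n 1) :
    Function.Surjective (toTwisted f) := by
  intro x
  obtain ⟨v, rfl⟩ := Submodule.mkQ_surjective _ x
  obtain ⟨A, hA⟩ := exists_eq_add_sOp hf fun m => coeffForm m v
  refine ⟨A 0, ?_⟩
  rw [toTwisted_apply, Submodule.mkQ_apply, Submodule.mkQ_apply, Submodule.Quotient.eq]
  -- With η_m = h(A_{m+1}) one has df ∧ η_m = S(A_{m+1}) = A_m - v_m and dη_m = A_{m+1}, so (df - s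
  -- d)η telescopes to A_0 - v.
  refine ⟨mkForm fun m => homotopy (sub_add_cancel (n : ℤ) 1) (A (m + 1)),
    formS_ext fun m => ?_⟩
  rcases m with _ | m
  · rw [coeffForm_zero_twistedD, coeffForm_mkForm, map_sub, coeffForm_zero_constForm, hA 0,
      add_sub_cancel_left, sOp_apply]
  · rw [coeffForm_succ_twistedD, coeffForm_mkForm, coeffForm_mkForm, map_sub,
      coeffForm_succ_constForm, formalExt_homotopy_top hn, hA (m + 1), ← sOp_apply]
    abel

/-! ### Convergent forms as formal forms -/

/-- The inclusion of the convergent forms into the formal forms. -/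
def convForm {n : ℕ} {p : ℤ} : Form (Conv n) n p →ₗ[ℂ] Form (MvPowerSeries (Fin n) ℂ) n p where
  toFun ω I := (ω I : MvPowerSeries (Fin n) ℂ)
  map_add' _ _ := rfl
  map_smul' _ _ := rfl

theorem convForm_convExt {n : ℕ} {p q : ℤ} (h : p + 1 = q) (ω : Form (Conv n) n p) :
    convForm (convExt h ω) = formalExt h (convForm ω) :=
  map_wedgeOp convD formalD (Conv n).val.toAddMonoidHom (fun _ _ => rfl) h ω

theorem convForm_convDf {n : ℕ} (f : Conv n) {p q : ℤ} (h : p + 1 = q) (ω : Form (Conv n) n p) :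
    convForm (convDf f h ω) = formalDf (f : MvPowerSeries (Fin n) ℂ) h (convForm ω) :=
  map_wedgeOp (fun j => LinearMap.mulLeft ℂ (convD j f)) (mulD (f : MvPowerSeries (Fin n) ℂ))
    (Conv n).val.toAddMonoidHom (fun _ _ => rfl) h ω

theorem convForm_injective {n : ℕ} {p : ℤ} :
    Function.Injective (convForm : Form (Conv n) n p → Form (MvPowerSeries (Fin n) ℂ) n p) :=
  fun _ _ h => funext fun I => Subtype.ext (congrFun h I)

theorem convForm_mem_formalExactPart {n : ℕ} {f : Conv n} {ω : Form (Conv n) n (n : ℤ)}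
    (h : ω ∈ exactPart f) : convForm ω ∈ formalExactPart (f : MvPowerSeries (Fin n) ℂ) := by
  obtain ⟨ξ, rfl⟩ := h
  refine ⟨convForm ξ, ?_⟩
  rw [LinearMap.comp_apply, LinearMap.comp_apply, convForm_convDf, convForm_convExt]

theorem mem_convIdeal_smul_top {n k : ℕ} {p : ℤ} {ω : Form (Conv n) n p} :
    ω ∈ (convIdeal n ^ k) • (⊤ : Submodule (Conv n) (Form (Conv n) n p)) ↔
      convForm ω ∈ ordForm n k p := by
  rw [mem_ideal_smul_top_pi]
  exact forall_congr' fun I => mem_convIdeal_pow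

theorem mem_formalIdeal_smul_top {n k : ℕ} {p : ℤ} {ω : Form (MvPowerSeries (Fin n) ℂ) n p} :
    ω ∈ (formalIdeal n ^ k) •
      (⊤ : Submodule (MvPowerSeries (Fin n) ℂ) (Form (MvPowerSeries (Fin n) ℂ) n p)) ↔
      ω ∈ ordForm n k p := by
  rw [mem_ideal_smul_top_pi, formalIdeal_pow]
  rfl

/-- The sum of the terms of degree less than `k`. -/
def truncDegree {n : ℕ} (k : ℕ) (g : MvPowerSeries (Fin n) ℂ) : Conv n :=
  ⟨fun α => if α.degree < k then coeff α g else 0, 1, one_pos, by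
    refine summable_of_ne_finset_zero
      (s := (Finsupp.finite_of_degree_lt (σ := Fin n) k).toFinset) fun α hα => ?_
    have h1 : ¬ α.degree < k := by simpa using hα
    have h2 : coeff α (fun α => if α.degree < k then coeff α g else 0 : MvPowerSeries (Fin n) ℂ) =
      if α.degree < k then coeff α g else 0 := rfl
    rw [h2, if_neg h1, norm_zero, zero_mul]⟩

theorem sub_truncDegree_mem {n : ℕ} (k : ℕ) (g : MvPowerSeries (Fin n) ℂ) :
    g - truncDegree k g ∈ ordIdeal n k := by
  intro α hα
  have h2 : coeff α (truncDegree k g : MvPowerSeries (Fin n) ℂ) =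
    if α.degree < k then coeff α g else 0 := rfl
  rw [map_sub, h2, if_pos hα, sub_self]

/-- The sum of the terms of degree less than `k` of the coefficients of a form. -/
def truncForm {n : ℕ} {p : ℤ} (k : ℕ) (ω : Form (MvPowerSeries (Fin n) ℂ) n p) :
    Form (Conv n) n p := fun I => truncDegree k (ω I)

theorem sub_truncForm_mem {n : ℕ} {p : ℤ} (k : ℕ) (ω : Form (MvPowerSeries (Fin n) ℂ) n p) :
    ω - convForm (truncForm k ω) ∈ ordForm n k p := fun I => sub_truncDegree_mem k (ω I)

/-! ### Elements of the formal Brieskorn lattice -/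

theorem toFormal_eq_iff {n : ℕ} (f : Conv n) (k : ℕ) (ω ω' : Form (Conv n) n (n : ℤ)) :
    (toFormal f ω).1 k = (toFormal f ω').1 k ↔
      ∃ ℓ ∈ exactPart f, convForm (ω - ω' - ℓ) ∈ ordForm n k (n : ℤ) := by
  have h1 : (toFormal f ω).1 k = (toFormal f ω').1 k ↔
      (exactPart f).mkQ (ω - ω') ∈ filt f k := by
    rw [map_sub]
    exact Submodule.Quotient.eq (filt f k)
  rw [h1, filt, Submodule.mem_map]
  constructor
  · rintro ⟨y, hy, hyω⟩
    refine ⟨ω - ω' - y, (Submodule.Quotient.eq _).1 hyω.symm, ?_⟩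
    rw [sub_sub_cancel]
    exact mem_convIdeal_smul_top.1 hy
  · rintro ⟨ℓ, hℓ, h⟩
    refine ⟨ω - ω' - ℓ, mem_convIdeal_smul_top.2 h, (Submodule.Quotient.eq _).2 ?_⟩
    rw [sub_sub_cancel_left]
    exact Submodule.neg_mem _ hℓ

theorem toFormal_eq_of_mem {n : ℕ} (f : Conv n) {k : ℕ} {ω ω' : Form (Conv n) n (n : ℤ)}
    (h : convForm ω - convForm ω' ∈ ordForm n k (n : ℤ)) :
    (toFormal f ω).1 k = (toFormal f ω').1 k :=
  (toFormal_eq_iff f k ω ω').2 ⟨0, Submodule.zero_mem _, by rwa [sub_zero, map_sub]⟩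

/-- The element of the formal Brieskorn lattice represented by a formal form. -/
def ofForm {n : ℕ} (f : Conv n) :
    Form (MvPowerSeries (Fin n) ℂ) n (n : ℤ) →+ FormalLattice f where
  toFun ω := ⟨fun k => (toFormal f (truncForm k ω)).1 k, fun k => by
    refine toFormal_eq_of_mem f (?_ : convForm (truncForm (k + 1) ω) - _ ∈ _)
    rw [← sub_sub_sub_cancel_left _ _ ω]
    exact Submodule.sub_mem _ (sub_truncForm_mem k ω)
      (ordForm_antitone (Nat.le_succ k) (sub_truncForm_mem (k + 1) ω))⟩
  map_zero' := by
    refine Subtype.ext (funext fun k => ?_)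
    refine toFormal_eq_of_mem f (ω' := 0) ?_
    rw [map_zero, sub_zero, ← neg_mem_iff, ← zero_sub]
    exact sub_truncForm_mem k 0
  map_add' ω ω' := by
    refine Subtype.ext (funext fun k => ?_)
    refine toFormal_eq_of_mem f (ω' := truncForm k ω + truncForm k ω') ?_
    have h := Submodule.sub_mem _ (Submodule.add_mem _ (sub_truncForm_mem k ω)
      (sub_truncForm_mem k ω')) (sub_truncForm_mem k (ω + ω'))
    rw [map_add]
    convert h using 1
    abel

theorem ofForm_eq_toFormal {n : ℕ} (f : Conv n) {ω : Form (MvPowerSeries (Fin n) ℂ) n (n : ℤ)}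
    {ω' : Form (Conv n) n (n : ℤ)} {k : ℕ} (h : ω - convForm ω' ∈ ordForm n k (n : ℤ)) :
    (ofForm f ω).1 k = (toFormal f ω').1 k := by
  refine toFormal_eq_of_mem f ?_
  rw [← sub_sub_sub_cancel_left _ _ ω]
  exact Submodule.sub_mem _ h (sub_truncForm_mem k ω)

theorem ofForm_convForm {n : ℕ} (f : Conv n) (ω : Form (Conv n) n (n : ℤ)) :
    ofForm f (convForm ω) = toFormal f ω :=
  Subtype.ext (funext fun _ => ofForm_eq_toFormal f (by rw [sub_self]; exact Submodule.zero_mem _))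

theorem ofForm_smul {n : ℕ} (f : Conv n) (a : ℂ) (ω : Form (MvPowerSeries (Fin n) ℂ) n (n : ℤ)) :
    ofForm f (a • ω) = a • ofForm f ω := by
  refine Subtype.ext (funext fun k => ?_)
  refine ofForm_eq_toFormal f (ω' := a • truncForm k ω) ?_
  rw [map_smul, ← smul_sub]
  exact Submodule.smul_mem _ _ (sub_truncForm_mem k ω)

theorem represents_iff {n : ℕ} (f : Conv n) (ω : Form (MvPowerSeries (Fin n) ℂ) n (n : ℤ))
    (h : FormalLattice f) : Represents f ω h ↔ ofForm f ω = h := by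
  constructor
  · intro H
    refine Subtype.ext (funext fun k => ?_)
    obtain ⟨ω', h1, h2⟩ := H k
    rw [h1]
    exact ofForm_eq_toFormal f (mem_formalIdeal_smul_top.1 h2)
  · rintro rfl k
    exact ⟨truncForm k ω, rfl, mem_formalIdeal_smul_top.2 (sub_truncForm_mem k ω)⟩

/-- Passes from holomorphic to formal forms: modulo order k, df ∧ dξ with ξ formal can be replaced
by df ∧ dξ' with ξ' a truncation of ξ. -/
theorem ofForm_eq_zero_iff_exists {n : ℕ} {f : Conv n}
    (hf : ∀ i, MvPowerSeries.pderiv ℂ i (f : MvPowerSeries (Fin n) ℂ) ∈ ordIdeal n 1)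
    (ω : Form (MvPowerSeries (Fin n) ℂ) n (n : ℤ)) (k : ℕ) :
    (ofForm f ω).1 k = 0 ↔ ∃ ℓ ∈ formalExactPart (f : MvPowerSeries (Fin n) ℂ),
      ω - ℓ ∈ ordForm n k (n : ℤ) := by
  have h0 : (ofForm f ω).1 k = 0 ↔
      (toFormal f (truncForm k ω)).1 k = (toFormal f 0).1 k := Iff.rfl
  rw [h0, toFormal_eq_iff]
  constructor
  · rintro ⟨ℓ, hℓ, h⟩
    refine ⟨convForm ℓ, convForm_mem_formalExactPart hℓ, ?_⟩
    rw [sub_zero, map_sub] at h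
    rw [← sub_add_sub_cancel _ (convForm (truncForm k ω))]
    exact Submodule.add_mem _ (sub_truncForm_mem k ω) h
  · rintro ⟨_, ⟨ξ, rfl⟩, h⟩
    -- One extra order is kept because d lowers the order by one.
    refine ⟨_, ⟨truncForm (k + 1) ξ, rfl⟩, ?_⟩
    have h1 := formalDf_mem_ordForm hf (sub_add_cancel (n : ℤ) 1) (formalExt_mem_ordForm
      (show (n : ℤ) - 2 + 1 = n - 1 by ring) (sub_truncForm_mem (k + 1) ξ))
    rw [map_sub, map_sub] at h1
    rw [LinearMap.comp_apply] at h
    have h2 := Submodule.add_mem _ (Submodule.sub_mem _ h (sub_truncForm_mem k ω))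
      (ordForm_antitone (Nat.le_succ k) h1)
    rw [sub_zero, map_sub, LinearMap.comp_apply, convForm_convDf, convForm_convExt]
    convert h2 using 1
    abel

theorem ofForm_apply_eq_zero {n : ℕ} (f : Conv n)
    {ω : Form (MvPowerSeries (Fin n) ℂ) n (n : ℤ)} {k : ℕ} (h : ω ∈ ordForm n k (n : ℤ)) :
    (ofForm f ω).1 k = 0 :=
  ofForm_eq_toFormal f (ω' := 0) (by rwa [map_zero, sub_zero])

theorem ofForm_eq_zero_iff {n : ℕ} {f : Conv n}
    (hf : ∀ i, MvPowerSeries.pderiv ℂ i (f : MvPowerSeries (Fin n) ℂ) ∈ ordIdeal n 1)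
    (ω : Form (MvPowerSeries (Fin n) ℂ) n (n : ℤ)) :
    ofForm f ω = 0 ↔ ω ∈ formalExactPart (f : MvPowerSeries (Fin n) ℂ) := by
  constructor
  · intro h
    exact mem_formalExactPart_of_forall hf fun k =>
      (ofForm_eq_zero_iff_exists hf ω k).1 (congrFun (congrArg Subtype.val h) k)
  · intro h
    refine Subtype.ext (funext fun k => (ofForm_eq_zero_iff_exists hf ω k).2 ⟨ω, h, ?_⟩)
    rw [sub_self]
    exact Submodule.zero_mem _

theorem exists_toFormal_eq {n : ℕ} {f : Conv n} (h : FormalLattice f) (k : ℕ) :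
    ∃ ω, h.1 k = (toFormal f ω).1 k := by
  obtain ⟨y, hy⟩ := Submodule.mkQ_surjective _ (h.1 k)
  obtain ⟨ω, rfl⟩ := Submodule.mkQ_surjective _ y
  exact ⟨ω, hy.symm⟩

/-- Lifts of the components are chosen successively, each corrected by an element of df ∧ dΩ^{n-2}
so that it agrees with the previous one to order k. They converge because Ω̂^n is complete. -/
theorem ofForm_surjective {n : ℕ} (f : Conv n) : Function.Surjective (ofForm f) := by
  intro h
  have step : ∀ (k : ℕ) (ω : Form (Conv n) n (n : ℤ)), h.1 k = (toFormal f ω).1 k →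
      ∃ ω', h.1 (k + 1) = (toFormal f ω').1 (k + 1) ∧
        convForm ω' - convForm ω ∈ ordForm n k (n : ℤ) := by
    intro k ω hω
    obtain ⟨ω₁, h1⟩ := exists_toFormal_eq h (k + 1)
    have h2 : (toFormal f ω₁).1 k = (toFormal f ω).1 k := by
      rw [← hω, ← h.2 k, h1]
      rfl
    obtain ⟨ℓ, hℓ, h3⟩ := (toFormal_eq_iff f k _ _).1 h2
    refine ⟨ω₁ - ℓ, ?_, ?_⟩
    · rw [h1, toFormal_eq_iff]
      refine ⟨ℓ, hℓ, ?_⟩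
      rw [sub_sub_cancel, sub_self, map_zero]
      exact Submodule.zero_mem _
    · rwa [← map_sub, sub_right_comm]
  obtain ⟨ω₀, h₀⟩ := exists_toFormal_eq h 0
  choose next hnext using step
  let S : ∀ k, {ω : Form (Conv n) n (n : ℤ) // h.1 k = (toFormal f ω).1 k} := fun k =>
    Nat.rec ⟨ω₀, h₀⟩ (fun k s => ⟨next k s.1 s.2, (hnext k s.1 s.2).1⟩) k
  obtain ⟨A, hA⟩ := exists_limit (fun k => convForm (S k).1)
    fun k => (hnext k (S k).1 (S k).2).2
  refine ⟨A, Subtype.ext (funext fun k => ?_)⟩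
  rw [(S k).2]
  exact ofForm_eq_toFormal f (hA k)

/-! ### The module structure -/

theorem pderiv_mem_ordIdeal_one {n : ℕ} {f : Conv n} (hf : HasIsolatedCriticalPoint f)
    (i : Fin n) : MvPowerSeries.pderiv ℂ i (f : MvPowerSeries (Fin n) ℂ) ∈ ordIdeal n 1 := by
  have h : convD i f ∈ convIdeal n ^ 1 := by
    rw [pow_one]
    exact hf.2 (Ideal.subset_span ⟨i, rfl⟩)
  exact mem_convIdeal_pow.1 h

/-- As `sOp` raises the order, s^M maps Ĥ'' to classes of forms of order at least M; this yields
both the continuity and the limit condition. -/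
theorem isFormalLatticeModule_of_smul_ofForm {n : ℕ} {f : Conv n}
    (hf : ∀ i, MvPowerSeries.pderiv ℂ i (f : MvPowerSeries (Fin n) ℂ) ∈ ordIdeal n 1)
    [Module (PowerSeries ℂ) (FormalLattice f)]
    (hC : ∀ a ω, (PowerSeries.C a : PowerSeries ℂ) • ofForm f ω = ofForm f (a • ω))
    (hX : ∀ ω, (PowerSeries.X : PowerSeries ℂ) • ofForm f ω =
      ofForm f (sOp (f : MvPowerSeries (Fin n) ℂ) ω))
    (hd : ∀ η, (PowerSeries.X : PowerSeries ℂ) •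
      ofForm f (formalExt (sub_add_cancel (n : ℤ) 1) η) =
        ofForm f (formalDf (f : MvPowerSeries (Fin n) ℂ) (sub_add_cancel (n : ℤ) 1) η)) :
    IsFormalLatticeModule f where
  C_smul a h := by
    obtain ⟨ω, rfl⟩ := ofForm_surjective f h
    rw [hC, ofForm_smul]
  X_smul η := by
    rw [← ofForm_convForm, ← ofForm_convForm, convForm_convExt, convForm_convDf, hd]
  X_continuous k := by
    refine ⟨k, fun h hk => ?_⟩
    obtain ⟨ω, rfl⟩ := ofForm_surjective f h
    obtain ⟨ℓ, hℓ, h1⟩ := (ofForm_eq_zero_iff_exists hf ω k).1 hk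
    -- Replace the representative by one that itself has order at least k.
    have h2 : ofForm f ω = ofForm f (ω - ℓ) := by
      rw [map_sub, (ofForm_eq_zero_iff hf ℓ).2 hℓ, sub_zero]
    rw [h2, hX]
    exact ofForm_apply_eq_zero f (ordForm_antitone (Nat.le_succ k) (sOp_mem_ordForm hf h1))
  smul_limit u h k := by
    have hpow : ∀ (M : ℕ) (h : FormalLattice f), ∃ ω ∈ ordForm n M (n : ℤ),
        (PowerSeries.X ^ M : PowerSeries ℂ) • h = ofForm f ω := by
      intro M
      induction M with
      | zero =>
        intro h
        obtain ⟨ω, rfl⟩ := ofForm_surjective f h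
        exact ⟨ω, mem_ordForm_zero _, by rw [pow_zero, one_smul]⟩
      | succ M ih =>
        intro h
        obtain ⟨ω, hω, h1⟩ := ih h
        exact ⟨_, sOp_mem_ordForm hf hω, by rw [pow_succ', mul_smul, h1, hX]⟩
    refine ⟨k, fun M hM => ?_⟩
    have hdvd : (PowerSeries.X ^ M : PowerSeries ℂ) ∣
        u - ((PowerSeries.trunc M u : Polynomial ℂ) : PowerSeries ℂ) := by
      rw [PowerSeries.X_pow_dvd_iff]
      intro m hm
      rw [map_sub, Polynomial.coeff_coe, PowerSeries.coeff_trunc, if_pos hm, sub_self]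
    obtain ⟨v, hv⟩ := hdvd
    obtain ⟨ω, hω, h1⟩ := hpow M (v • h)
    have h2 : u • h = ((PowerSeries.trunc M u : Polynomial ℂ) : PowerSeries ℂ) • h +
        ofForm f ω := by
      rw [← h1, smul_smul, ← hv, ← add_smul, add_sub_cancel]
    have h3 := ofForm_apply_eq_zero f (ordForm_antitone hM hω)
    rw [h2, Submodule.coe_add, Pi.add_apply, h3, add_zero]

theorem isConvergent_homotopy {n : ℕ} {p q : ℤ} (h : p + 1 = q) (ω : Form (Conv n) n q)
    (J : {J : Finset (Fin n) // (J.card : ℤ) = p}) : homotopy h (convForm ω) J ∈ Conv n := by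
  rw [homotopy_apply, contract]
  refine sum_mem fun l _ => zsmul_mem (mul_mem (isConvergent_X l) ?_) _
  unfold Form.coef
  split_ifs
  · exact IsConvergent.eulerInv _ (ω _).2
  · exact zero_mem _

/-- Every convergent top form is exact. -/
theorem exists_convExt_eq {n : ℕ} (hn : 1 ≤ n) (ω : Form (Conv n) n (n : ℤ)) :
    ∃ η, convExt (sub_add_cancel (n : ℤ) 1) η = ω := by
  refine ⟨fun J => ⟨homotopy (sub_add_cancel (n : ℤ) 1) (convForm ω) J,
    isConvergent_homotopy _ ω J⟩, convForm_injective ?_⟩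
  rw [convForm_convExt]
  exact formalExt_homotopy_top hn (convForm ω)

/-- Density of the classes of exact holomorphic forms: truncations are convergent, and every
convergent top form is exact. -/
theorem exists_convExt_approx {n : ℕ} (hn : 1 ≤ n) {f : Conv n} (h : FormalLattice f) (K : ℕ) :
    ∃ η, ∀ m ≤ K, (h - toFormal f (convExt (sub_add_cancel (n : ℤ) 1) η)).1 m = 0 := by
  obtain ⟨ω, rfl⟩ := ofForm_surjective f h
  obtain ⟨η, hη⟩ := exists_convExt_eq hn (truncForm K ω)
  refine ⟨η, fun m hm => ?_⟩
  rw [hη, ← ofForm_convForm, ← map_sub]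
  exact ofForm_apply_eq_zero f (ordForm_antitone hm (sub_truncForm_mem K ω))

theorem IsFormalLatticeModule.X_smul_apply_eq {n : ℕ} {f : Conv n}
    [Module (PowerSeries ℂ) (FormalLattice f)] (H : IsFormalLatticeModule f) (k : ℕ) :
    ∃ m, ∀ (h : FormalLattice f) (η : Form (Conv n) n ((n : ℤ) - 1)),
      (h - toFormal f (convExt (sub_add_cancel (n : ℤ) 1) η)).1 m = 0 →
      ((PowerSeries.X : PowerSeries ℂ) • h).1 k =
        (toFormal f (convDf f (sub_add_cancel (n : ℤ) 1) η)).1 k := by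
  obtain ⟨m, hm⟩ := H.X_continuous k
  refine ⟨m, fun h η hη => ?_⟩
  have h1 := hm _ hη
  rw [smul_sub, H.X_smul, Submodule.coe_sub, Pi.sub_apply, sub_eq_zero] at h1
  exact h1

/-- By density and continuity the two actions of s agree; with the constants this settles
polynomials, and truncations settle all power series. -/
theorem IsFormalLatticeModule.unique {n : ℕ} (hn : 1 ≤ n) {f : Conv n}
    (M M' : Module (PowerSeries ℂ) (FormalLattice f)) (H : @IsFormalLatticeModule n f M)
    (H' : @IsFormalLatticeModule n f M') : M' = M := by
  let φ := @Module.toAddMonoidEnd (PowerSeries ℂ) (FormalLattice f) _ _ M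
  let φ' := @Module.toAddMonoidEnd (PowerSeries ℂ) (FormalLattice f) _ _ M'
  have hX : φ' PowerSeries.X = φ PowerSeries.X := by
    refine AddMonoidHom.ext fun h => Subtype.ext (funext fun k => ?_)
    obtain ⟨m, hm⟩ := @IsFormalLatticeModule.X_smul_apply_eq n f M H k
    obtain ⟨m', hm'⟩ := @IsFormalLatticeModule.X_smul_apply_eq n f M' H' k
    obtain ⟨η, hη⟩ := exists_convExt_approx hn h (max m m')
    exact (hm' h η (hη _ (le_max_right _ _))).trans (hm h η (hη _ (le_max_left _ _))).symm
  have hC : ∀ a, φ' (PowerSeries.C a) = φ (PowerSeries.C a) := fun a =>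
    AddMonoidHom.ext fun h => (@IsFormalLatticeModule.C_smul n f M' H' a h).trans
      (@IsFormalLatticeModule.C_smul n f M H a h).symm
  have hpoly : φ'.comp Polynomial.coeToPowerSeries.ringHom =
      φ.comp Polynomial.coeToPowerSeries.ringHom := by
    refine Polynomial.ringHom_ext (fun a => ?_) ?_
    · simpa using hC a
    · simpa using hX
  refine Module.ext' _ _ fun u h => Subtype.ext (funext fun k => ?_)
  obtain ⟨N, hN⟩ := @IsFormalLatticeModule.smul_limit n f M H u h k
  obtain ⟨N', hN'⟩ := @IsFormalLatticeModule.smul_limit n f M' H' u h k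
  refine (hN' (max N N') (le_max_right _ _)).trans (Eq.trans ?_
    (hN (max N N') (le_max_left _ _)).symm)
  have h1 := RingHom.congr_fun hpoly (PowerSeries.trunc (max N N') u)
  exact congrFun (congrArg Subtype.val (DFunLike.congr_fun h1 h)) k

/-- The isomorphism `[ω] ↦ [ω]` of abelian groups. -/
theorem exists_addEquiv {n : ℕ} (hn : 2 ≤ n) {f : Conv n}
    (hf : ∀ i, MvPowerSeries.pderiv ℂ i (f : MvPowerSeries (Fin n) ℂ) ∈ ordIdeal n 1) :
    ∃ e : FormalLattice f ≃+ TwistedQuotient f, ∀ ω, e (ofForm f ω) = toTwisted f ω := by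
  -- Both kernels are df ∧ dΩ̂^{n-2}.
  have hker : (ofForm f).ker = (toTwisted f).ker := by
    ext ω
    rw [AddMonoidHom.mem_ker, AddMonoidHom.mem_ker, ofForm_eq_zero_iff hf]
    exact ⟨toTwisted_eq_zero_of_mem f, mem_of_toTwisted_eq_zero hn hf⟩
  let e₁ := QuotientAddGroup.quotientKerEquivOfSurjective (ofForm f) (ofForm_surjective f)
  let e₂ := QuotientAddGroup.quotientKerEquivOfSurjective (toTwisted f)
    (toTwisted_surjective (by omega) hf)
  refine ⟨e₁.symm.trans ((QuotientAddGroup.quotientAddEquivOfEq hker).trans e₂), fun ω => ?_⟩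
  have h1 : e₁.symm (ofForm f ω) = QuotientAddGroup.mk ω := by
    rw [AddEquiv.symm_apply_eq]
    rfl
  rw [AddEquiv.trans_apply, h1]
  rfl

theorem exists_formalLatticeModule {n : ℕ} (hn : 2 ≤ n) {f : Conv n}
    (hf : ∀ i, MvPowerSeries.pderiv ℂ i (f : MvPowerSeries (Fin n) ℂ) ∈ ordIdeal n 1) :
    ∃ _ : Module (PowerSeries ℂ) (FormalLattice f), IsFormalLatticeModule f ∧
      ∃ Φ : FormalLattice f ≃ₗ[PowerSeries ℂ] TwistedQuotient f,
        ∀ ω, Φ (ofForm f ω) = toTwisted f ω := by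
  obtain ⟨e, he⟩ := exists_addEquiv hn hf
  let inst : Module (PowerSeries ℂ) (FormalLattice f) := e.module (PowerSeries ℂ)
  let Φ : FormalLattice f ≃ₗ[PowerSeries ℂ] TwistedQuotient f :=
    { e with map_smul' := fun u h => e.apply_symm_apply _ }
  have hΦ : ∀ ω, Φ (ofForm f ω) = toTwisted f ω := he
  -- For the transported structure the required identities can be checked in the twisted quotient.
  refine ⟨inst, isFormalLatticeModule_of_smul_ofForm hf (fun a ω => Φ.injective ?_)
    (fun ω => Φ.injective ?_) (fun η => Φ.injective ?_), Φ, hΦ⟩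
  · rw [map_smul, hΦ, hΦ, C_smul_toTwisted]
  · rw [map_smul, hΦ, hΦ, X_smul_toTwisted (by omega)]
  · rw [map_smul, hΦ, hΦ, X_smul_toTwisted_formalExt]

/-! ### The family quotient -/

theorem coeff_seriesD {n : ℕ} (i : Fin n) (g : PowerSeries (MvPowerSeries (Fin n) ℂ))
    (m : ℕ) : PowerSeries.coeff m (seriesD i g) =
      MvPowerSeries.pderiv ℂ i (PowerSeries.coeff m g) :=
  PowerSeries.coeff_mk m fun k => MvPowerSeries.pderiv ℂ i (PowerSeries.coeff k g)

/-- The monomial s^m x^α has exponent `α.optionElim m`, so ∂_i shifts only α and leaves the power of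
s alone. -/
theorem optionEquivLeft_sxD {n : ℕ} (i : Fin n) (g : SX n) :
    MvPowerSeries.optionEquivLeft (Fin n) ℂ (sxD i g) =
      seriesD i (MvPowerSeries.optionEquivLeft (Fin n) ℂ g) := by
  classical
  ext m α
  have h1 : sxD i g = MvPowerSeries.pderiv ℂ (some i) g := rfl
  have h2 : (α + Finsupp.single i 1).optionElim m =
      α.optionElim m + Finsupp.single (some i) 1 := by
    ext a
    cases a <;> simp [Finsupp.single_apply]
  rw [coeff_seriesD, MvPowerSeries.coeff_pderiv, h1,
    MvPowerSeries.coeff_coeff_optionEquivLeft, MvPowerSeries.coeff_coeff_optionEquivLeft,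
    MvPowerSeries.coeff_pderiv, h2]
  simp

theorem optionEquivLeft_inclX {n : ℕ} (g : MvPowerSeries (Fin n) ℂ) :
    MvPowerSeries.optionEquivLeft (Fin n) ℂ (inclX n g) = PowerSeries.C g := by
  classical
  ext m α
  rw [MvPowerSeries.coeff_coeff_optionEquivLeft, PowerSeries.coeff_C, inclX]
  split_ifs with h
  · subst h
    have h1 : α.optionElim 0 = Finsupp.embDomain Function.Embedding.some α := by
      ext a
      cases a with
      | none => simp [Finsupp.embDomain_of_notMem_range]
      | some a =>
        rw [Finsupp.optionElim_apply_some]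
        exact (Finsupp.embDomain_apply_self Function.Embedding.some α a).symm
    rw [h1]
    exact MvPowerSeries.coeff_embDomain_rename Function.Embedding.some g α
  · rw [map_zero]
    refine MvPowerSeries.coeff_rename_eq_zero (f := some) g ?_
    rintro ⟨y, hy⟩
    have h1 := DFunLike.congr_fun hy none
    rw [Finsupp.mapDomain_of_notMem_range _ _ (by simp)] at h1
    exact h (by simpa using h1.symm)

theorem optionEquivLeft_algebraMap {n : ℕ} (u : PowerSeries ℂ) :
    MvPowerSeries.optionEquivLeft (Fin n) ℂ (algebraMap (PowerSeries ℂ) (SX n) u) =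
      algebraMap (PowerSeries ℂ) (PowerSeries (MvPowerSeries (Fin n) ℂ)) u := by
  classical
  ext m α
  have h0 : PowerSeries.coeff m (algebraMap (PowerSeries ℂ)
      (PowerSeries (MvPowerSeries (Fin n) ℂ)) u) = MvPowerSeries.C (PowerSeries.coeff m u) := rfl
  rw [MvPowerSeries.coeff_coeff_optionEquivLeft, h0, MvPowerSeries.coeff_C]
  split_ifs with h
  · subst h
    let e : Unit ↪ Option (Fin n) := ⟨fun _ => none, fun _ _ _ => rfl⟩
    have h1 : (0 : Fin n →₀ ℕ).optionElim m = Finsupp.embDomain e (Finsupp.single () m) := by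
      have h2 : (0 : Fin n →₀ ℕ).optionElim m = Finsupp.single none m := by
        ext a
        cases a <;> simp
      exact h2.trans (Finsupp.embDomain_single e () m).symm
    rw [h1]
    exact MvPowerSeries.coeff_embDomain_rename e u (Finsupp.single () m)
  · refine MvPowerSeries.coeff_rename_eq_zero (f := fun _ : Unit => (none : Option (Fin n))) u ?_
    rintro ⟨y, hy⟩
    refine h (Finsupp.ext fun i => ?_)
    have h1 := DFunLike.congr_fun hy (some i)
    rw [Finsupp.mapDomain_of_notMem_range _ _ (by simp)] at h1
    simpa using h1.symm

/-- The isomorphism `g ↦ g dx_1 ∧ ⋯ ∧ dx_n`. -/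
def topEquiv (n : ℕ) : SX n ≃ₗ[PowerSeries ℂ] FormS n (n : ℤ) where
  toFun g := topForm n (MvPowerSeries.optionEquivLeft (Fin n) ℂ g)
  map_add' g g' := by funext I; exact map_add (MvPowerSeries.optionEquivLeft (Fin n) ℂ) g g'
  map_smul' u g := by
    funext I
    simp only [topForm, Algebra.smul_def, map_mul, optionEquivLeft_algebraMap, RingHom.id_apply,
      Pi.smul_apply]
  invFun ω := (MvPowerSeries.optionEquivLeft (Fin n) ℂ).symm (ω ⟨Finset.univ, by simp⟩)
  left_inv g := (MvPowerSeries.optionEquivLeft (Fin n) ℂ).symm_apply_apply g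
  right_inv ω := by
    funext I
    have h1 : I.1 = Finset.univ := by
      rw [← Finset.card_eq_iff_eq_univ, Fintype.card_fin]
      exact_mod_cast I.2
    obtain rfl : I = ⟨Finset.univ, by simp⟩ := Subtype.ext h1
    exact (MvPowerSeries.optionEquivLeft (Fin n) ℂ).apply_symm_apply _

theorem twistedD_apply_univ {n : ℕ} (f : Conv n) (η : FormS n ((n : ℤ) - 1))
    (I : {I : Finset (Fin n) // (I.card : ℤ) = n}) :
    twistedD f η I = ∑ j, sgn Finset.univ j •
      (PowerSeries.C (MvPowerSeries.pderiv ℂ j (f : MvPowerSeries (Fin n) ℂ)) *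
          Form.coef η (Finset.univ.erase j) -
        (PowerSeries.X : PowerSeries ℂ) • seriesD j (Form.coef η (Finset.univ.erase j))) := by
  have h1 : I.1 = Finset.univ := by
    rw [← Finset.card_eq_iff_eq_univ, Fintype.card_fin]
    exact_mod_cast I.2
  rw [twistedD, LinearMap.sub_apply, Pi.sub_apply, LinearMap.smul_apply, Pi.smul_apply, wedge,
    wedgeOp_apply, wedgeOp_apply, h1, Finset.smul_sum, ← Finset.sum_sub_distrib]
  refine Finset.sum_congr rfl fun j _ => ?_
  rw [smul_sub, smul_comm (PowerSeries.X : PowerSeries ℂ)]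
  rfl

theorem optionEquivLeft_familyOp {n : ℕ} (f : Conv n) (g : Fin n → SX n) :
    MvPowerSeries.optionEquivLeft (Fin n) ℂ (familyOp f g) =
      ∑ j, (PowerSeries.C (MvPowerSeries.pderiv ℂ j (f : MvPowerSeries (Fin n) ℂ)) *
          MvPowerSeries.optionEquivLeft (Fin n) ℂ (g j) -
        (PowerSeries.X : PowerSeries ℂ) •
          seriesD j (MvPowerSeries.optionEquivLeft (Fin n) ℂ (g j))) := by
  rw [familyOp, LinearMap.sum_apply, map_sum]
  refine Finset.sum_congr rfl fun j _ => ?_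
  rw [LinearMap.comp_apply, LinearMap.sub_apply, LinearMap.smul_apply, LinearMap.proj_apply,
    LinearMap.mulLeft_apply, map_sub, map_mul, optionEquivLeft_inclX, Algebra.smul_def, map_mul,
    optionEquivLeft_algebraMap, optionEquivLeft_sxD, ← Algebra.smul_def]

theorem sgn_smul_twisted {n : ℕ} (f : Conv n) (j : Fin n) (c : ℤ)
    (a : PowerSeries (MvPowerSeries (Fin n) ℂ)) :
    PowerSeries.C (MvPowerSeries.pderiv ℂ j (f : MvPowerSeries (Fin n) ℂ)) * (c • a) -
        (PowerSeries.X : PowerSeries ℂ) • seriesD j (c • a) =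
      c • (PowerSeries.C (MvPowerSeries.pderiv ℂ j (f : MvPowerSeries (Fin n) ℂ)) * a -
        (PowerSeries.X : PowerSeries ℂ) • seriesD j a) := by
  rw [map_zsmul, mul_smul_comm, smul_comm (PowerSeries.X : PowerSeries ℂ), smul_sub]

/-- The column (g_j) corresponds to the form with coefficient ± g_j at the complement of j; the sign
is the one in dx_j ∧ dx_{complement of j}, so it squares away. -/
theorem map_range_familyOp {n : ℕ} (f : Conv n) :
    (LinearMap.range (familyOp f)).map (topEquiv n : SX n →ₗ[PowerSeries ℂ] FormS n (n : ℤ)) =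
      LinearMap.range (twistedD f) := by
  have hcard : ∀ j : Fin n, (((Finset.univ.erase j).card : ℕ) : ℤ) = (n : ℤ) - 1 := fun j => by
    have := Finset.card_erase_add_one (Finset.mem_univ j)
    rw [Finset.card_univ, Fintype.card_fin] at this
    omega
  refine le_antisymm ?_ ?_
  · rintro _ ⟨_, ⟨g, rfl⟩, rfl⟩
    -- Jᶜ has exactly one element here; the sum names it without a choice.
    refine ⟨fun J => ∑ j ∈ J.1ᶜ, sgn Finset.univ j •
      MvPowerSeries.optionEquivLeft (Fin n) ℂ (g j), funext fun I => ?_⟩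
    rw [twistedD_apply_univ]
    refine Eq.trans ?_ (optionEquivLeft_familyOp f g).symm
    refine Finset.sum_congr rfl fun j _ => ?_
    have h1 : Form.coef (p := (n : ℤ) - 1) (fun J => ∑ j ∈ J.1ᶜ, sgn Finset.univ j •
        MvPowerSeries.optionEquivLeft (Fin n) ℂ (g j)) (Finset.univ.erase j) =
        sgn Finset.univ j • MvPowerSeries.optionEquivLeft (Fin n) ℂ (g j) := by
      rw [Form.coef, dif_pos (hcard j), Finset.compl_erase, Finset.compl_univ, insert_empty_eq,
        Finset.sum_singleton]
    rw [h1, sgn_smul_twisted, smul_smul, sgn_mul_self, one_smul]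
  · rintro _ ⟨η, rfl⟩
    refine ⟨_, ⟨fun j => (MvPowerSeries.optionEquivLeft (Fin n) ℂ).symm
      (sgn Finset.univ j • Form.coef η (Finset.univ.erase j)), rfl⟩, funext fun I => ?_⟩
    refine (optionEquivLeft_familyOp f _).trans ?_
    rw [twistedD_apply_univ]
    refine Finset.sum_congr rfl fun j _ => ?_
    rw [AlgEquiv.apply_symm_apply, sgn_smul_twisted]

end Brieskorn

end

theorem mainTheorem2 (n : ℕ) (hn : 1 ≤ n) (f : Brieskorn.Conv n)
    (hf0 : MvPowerSeries.constantCoeff (f : MvPowerSeries (Fin n) ℂ) = 0)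
    (hf : Brieskorn.HasIsolatedCriticalPoint f) :
    (∃ Ψ : Brieskorn.FamilyQuotient f ≃ₗ[PowerSeries ℂ] Brieskorn.TwistedQuotient f,
      ∀ g : Brieskorn.SX n,
        Ψ ((LinearMap.range (Brieskorn.familyOp f)).mkQ g) =
          (LinearMap.range (Brieskorn.twistedD f)).mkQ
            (Brieskorn.topForm n (MvPowerSeries.optionEquivLeft (Fin n) ℂ g))) ∧
    (2 ≤ n →
      ∃ M : Module (PowerSeries ℂ) (Brieskorn.FormalLattice f),
        Brieskorn.IsFormalLatticeModule f ∧
        (∀ M' : Module (PowerSeries ℂ) (Brieskorn.FormalLattice f),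
          @Brieskorn.IsFormalLatticeModule n f M' → M' = M) ∧
        (∀ h : Brieskorn.FormalLattice f, ∃ ω, Brieskorn.Represents f ω h) ∧
        ∃ Φ : Brieskorn.FormalLattice f ≃ₗ[PowerSeries ℂ] Brieskorn.TwistedQuotient f,
          ∀ ω h, Brieskorn.Represents f ω h →
            Φ h = (LinearMap.range (Brieskorn.twistedD f)).mkQ (Brieskorn.constForm ω)) := by
  refine ⟨⟨Submodule.Quotient.equiv _ _ (Brieskorn.topEquiv n) (Brieskorn.map_range_familyOp f),
    fun g => rfl⟩, fun h2 => ?_⟩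
  obtain ⟨M, hM, Φ, hΦ⟩ :=
    Brieskorn.exists_formalLatticeModule h2 (Brieskorn.pderiv_mem_ordIdeal_one hf)
  refine ⟨M, hM, fun M' hM' => Brieskorn.IsFormalLatticeModule.unique hn M M' hM hM',
    fun h => ?_, Φ, fun ω h hω => ?_⟩
  · obtain ⟨ω, hω⟩ := Brieskorn.ofForm_surjective f h
    exact ⟨ω, (Brieskorn.represents_iff f ω h).2 hω⟩
  · rw [← (Brieskorn.represents_iff f ω h).1 hω, hΦ, Brieskorn.toTwisted_apply]
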